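/- Let $y_1\neq y_2$ be real and $0<c_0<c_1$. For $\lambda,\mu>0$ let $Y=(Y(t))_{t\ge 0}$ be a stationary Markov process with right-continuous paths, with the two states $y_1,y_2$ and transition rate matrix $\begin{pmatrix}-\lambda&\lambda\\ \mu&-\mu\end{pmatrix}$, let $W$ be a standard Wiener process independent of $Y$, and let $X_0$ be an initial value independent of $W$ with $\mathbf E X_0^2\le M<\infty$. One observes $$dX_t=Y(t)\,dt+dW_t,\qquad X(0)=X_0 .$$ For an integer $T\ge 1$ put $$\zeta_T=\frac1T\sum_{i=0}^{T-1}[X_{i+1}-X_i]^2-1,\qquad \eta_T=\Bigl(\frac{X_T}{T}-y_1\Bigr)\Bigl(y_2-\frac{X_T}{T}\Bigr),\qquad \Phi(x)=\frac1x-\frac{1}{x^2}\bigl(1-e^{-x}\bigr).$$ Let $J\subset(0,\infty)$ be a bounded interval, let $\mathcal A_T$ be the event that the equation $$\zeta_T=\Bigl(\frac{X_T}{T}\Bigr)^2+2\eta_T\,\Phi(\alpha)$$ has a solution $\alpha\in J$, let $\alpha_T\in J$ be such a solution on $\mathcal A_T$, and put $$\beta_T=\alpha_T\mathbf 1_{\mathcal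 A_T}+(c_0+c_1)\mathbf 1_{\mathcal A_T^c},\qquad \hat\lambda_T=\frac{\frac{X_T}{T}-y_1}{y_2-y_1}\,\beta_T,\qquad \hat\mu_T=\frac{y_2-\frac{X_T}{T}}{y_2-y_1}\,\beta_T .$$ Let $K\subset[c_0,c_1]\times[c_0,c_1]$ be a compact set such that $\lambda+\mu$ lies in the interior of $J$ for every $(\lambda,\mu)\in K$. Then there is a constant $C>0$, depending only on $y_1,y_2,c_0,c_1,M,J,K$, such that for all $(\lambda,\mu)\in K$ and all integers $T\ge 1$ $$\mathbf E_{\lambda,\mu}\bigl[\sqrt T(\hat\lambda_T-\lambda)\bigr]^2<C,\qquad \mathbf E_{\lambda,\mu}\bigl[\sqrt T(\hat\mu_T-\mu)\bigr]^2<C .$$ In particular this holds for $J=[2c_0,2c_1]$ and every compact $K\subset(c_0,c_1)\times(c_0,c_1)$, and, if $J$ contains a neighbourhood of $[2c_0,2c_1]$, for $K=[c_0,c_1]\times[c_0,c_1]$. -/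

import Mathlib

open MeasureTheory ProbabilityTheory
open scoped NNReal ENNReal

noncomputable section

namespace HiddenTelegraph

/-- The transition rate matrix of the two-state chain. -/
def rateMatrix (lam mu : ℝ) : Matrix (Fin 2) (Fin 2) ℝ :=
  !![-lam, lam; mu, -mu]

/-- The transition probability `P_{ij}(t) = P(Y(t) = y_j | Y(0) = y_i)`, an entry of the
matrix exponential `exp (t Q)` of the rate matrix `Q`. -/
def transition (lam mu : ℝ) (t : ℝ≥0) (i j : Fin 2) : ℝ :=
  (NormedSpace.exp ((t : ℝ) • rateMatrix lam mu)) i j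

/-- `Y` is a stationary Markov process with the two states `y 0`, `y 1`, the given transition rate
matrix and right-continuous paths. -/
structure IsTelegraph {Ω : Type*} [MeasurableSpace Ω] (P : Measure Ω)
    (y : Fin 2 → ℝ) (lam mu : ℝ) (Y : ℝ≥0 → Ω → ℝ) : Prop where
  measurable : ∀ t, Measurable (Y t)
  two_state : ∀ t ω, ∃ i, Y t ω = y i
  right_continuous : ∀ ω t, ContinuousWithinAt (fun s => Y s ω) (Set.Ici t) t
  /-- Markov property with transition matrices `exp (t Q)`, through finite-dimensional laws. -/
  markov : ∀ (n : ℕ) (t : Fin (n + 1) → ℝ≥0), Monotone t → ∀ i : Fin (n + 1) → Fin 2,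
    P.real {ω | ∀ k, Y (t k) ω = y (i k)} =
      P.real {ω | Y (t 0) ω = y (i 0)} *
        ∏ k : Fin n,
          transition lam mu (t k.succ - t k.castSucc) (i k.castSucc) (i k.succ)
  /-- The law of the whole process is invariant under time shifts. -/
  stationary : ∀ h : ℝ≥0,
    P.map (fun ω (t : ℝ≥0) => Y (h + t) ω) = P.map (fun ω (t : ℝ≥0) => Y t ω)

/-- The data of the hidden telegraph model: a telegraph process `Y`, a standard Wiener process `W`
independent of `Y`, and a square-integrable initial value `X₀` independent of `W`. -/
structure IsModel {Ω : Type*} [MeasurableSpace Ω] (P : Measure Ω)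
    (y : Fin 2 → ℝ) (lam mu : ℝ) (X₀ : Ω → ℝ) (Y W : ℝ≥0 → Ω → ℝ) : Prop where
  telegraph : IsTelegraph P y lam mu Y
  measurable_noise : ∀ t, Measurable (W t)
  wiener : IsBrownianReal W P
  indep : IndepFun (fun ω (t : ℝ≥0) => Y t ω) (fun ω (t : ℝ≥0) => W t ω) P
  initial_memLp : MemLp X₀ 2 P
  initial_indep : IndepFun X₀ (fun ω (t : ℝ≥0) => W t ω) P

/-- The observed path: `dX_t = Y(t) dt + dW_t`, `X(0) = X₀` (note `W 0 = 0` almost surely). -/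
def observation {Ω : Type*} (X₀ : Ω → ℝ) (Y W : ℝ≥0 → Ω → ℝ) (ω : Ω) (t : ℝ≥0) : ℝ :=
  X₀ ω + (∫ s in (0 : ℝ)..t, Y s.toNNReal ω) + W t ω

/-- `Φ(x) = 1/x - (1 - e^{-x})/x²`. -/
def Phi (x : ℝ) : ℝ := 1 / x - 1 / x ^ 2 * (1 - Real.exp (-x))

/-- `X_T / T`. -/
def mean (x : ℝ≥0 → ℝ) (T : ℕ) : ℝ := x T / T

/-- `ζ_T`, the normalized sum of squared unit increments. -/
def zeta (x : ℝ≥0 → ℝ) (T : ℕ) : ℝ :=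
  1 / (T : ℝ) * ∑ i ∈ Finset.range T, (x ((i : ℝ≥0) + 1) - x (i : ℝ≥0)) ^ 2 - 1

/-- `η_T = (X_T/T - y_1)(y_2 - X_T/T)`. -/
def eta (y : Fin 2 → ℝ) (x : ℝ≥0 → ℝ) (T : ℕ) : ℝ :=
  (mean x T - y 0) * (y 1 - mean x T)

/-- `a` solves the moment equation `ζ_T = (X_T/T)² + 2 η_T Φ(a)`. -/
def IsRoot (y : Fin 2 → ℝ) (x : ℝ≥0 → ℝ) (T : ℕ) (a : ℝ) : Prop :=
  zeta x T = mean x T ^ 2 + 2 * eta y x T * Phi a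

open Classical in
/-- `β_T`: the solution of the moment equation in `J` if there is one, and `c₀ + c₁` otherwise.
(For `J ⊆ (0, ∞)` there is at most one solution unless `η_T = 0`.) -/
def beta (y : Fin 2 → ℝ) (c₀ c₁ : ℝ) (J : Set ℝ) (x : ℝ≥0 → ℝ) (T : ℕ) : ℝ :=
  if h : ∃ a ∈ J, IsRoot y x T a then h.choose else c₀ + c₁

/-- The moment estimator of `λ`. -/
def lambdaHat (y : Fin 2 → ℝ) (c₀ c₁ : ℝ) (J : Set ℝ) (x : ℝ≥0 → ℝ) (T : ℕ) : ℝ :=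
  (mean x T - y 0) / (y 1 - y 0) * beta y c₀ c₁ J x T

/-- The moment estimator of `μ`. -/
def muHat (y : Fin 2 → ℝ) (c₀ c₁ : ℝ) (J : Set ℝ) (x : ℝ≥0 → ℝ) (T : ℕ) : ℝ :=
  (y 1 - mean x T) / (y 1 - y 0) * beta y c₀ c₁ J x T

end HiddenTelegraph

end

/-!
The estimators depend on the path only through two empirical moments, `X_T / T` and `ζ_T`, and the
moment equation is satisfied exactly by the true moments: if `m` is the stationary mean of `Y`, then
`E (∫₀¹ Y)² = m² + 2 (m - y₁)(y₂ - m) Φ(λ + μ)`, while `λ / (λ + μ)` and `μ / (λ + μ)` are the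
relative distances of `m` from `y₁` and `y₂`. The proof separates a deterministic statement from
a mean square estimate.

Deterministic part (`beta_error`): for every path, `(β_T - (λ + μ))²` is at most a constant times the
sum of the squared errors of the two empirical moments. If these errors are small, the equation has
a root near `λ + μ`, because `λ + μ` is uniformly inside `J`, and all roots in `J` are that near,
because `Φ` decreases at a positive linear rate on bounded sets (`Phi_sub_ge`,
`moment_root_stable`). If they are not small, the boundedness of `β_T` is enough.

Mean square part (`lintegral_sq_error_le`): both empirical moments have mean square error `O(1 / T)`.
They are averages over `i < T` of functionals of the increments `a_i + w_i`, where
`a_i = ∫ Y` over `[i, i + 1]` and `w_i` is the Wiener increment. Here `(a_i + w_i)² - 1` splits into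
`a_i²`, the cross term `2 a_i w_i`, which is orthogonal for different `i`, and `w_i² - 1`, which is
independent for different `i`. The variables `a_i` and `a_i²` have exponentially decaying
covariances: the four-dimensional laws of `Y` are explicit and the transition probabilities converge
to the stationary ones at rate `λ + μ ≥ 2 c₀` (`IsTelegraph.abs_cov_le`); the bound is integrated
over the four times by Fubini's theorem (`abs_cov_integral_le`). A geometric bound on covariances
makes the second moment of a sum of `T` terms `O(T)` (`integral_sq_sum_le`).
-/

namespace HiddenTelegraph

/-! ### The function `Φ` and stability of the moment equation -/

lemma Phi_eq_integral {x : ℝ} (hx : x ≠ 0) :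
    Phi x = ∫ s in (0 : ℝ)..1, (1 - s) * Real.exp (-x * s) := by
  have hd : ∀ s ∈ Set.uIcc (0 : ℝ) 1, HasDerivAt
      (fun s => -(1 - s) / x * Real.exp (-x * s) + Real.exp (-x * s) / x ^ 2)
      ((1 - s) * Real.exp (-x * s)) s := by
    intro s _
    have he : HasDerivAt (fun s : ℝ => Real.exp (-x * s)) (Real.exp (-x * s) * (-x)) s := by
      simpa using ((hasDerivAt_id s).const_mul (-x)).exp
    have hl : HasDerivAt (fun s : ℝ => -(1 - s) / x) (1 / x) s := by
      simpa using (((hasDerivAt_id s).const_sub 1).neg).div_const x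
    refine ((hl.mul he).add (he.div_const (x ^ 2))).congr_deriv ?_
    field_simp
    ring
  rw [intervalIntegral.integral_eq_sub_of_hasDerivAt hd
    ((by fun_prop : Continuous fun s : ℝ => (1 - s) * Real.exp (-x * s)).intervalIntegrable _ _)]
  simp only [Phi, mul_one, mul_zero, Real.exp_zero]
  field_simp
  ring

lemma abs_Phi_le_one {x : ℝ} (hx : 0 < x) : |Phi x| ≤ 1 := by
  rw [Phi_eq_integral hx.ne']
  have := intervalIntegral.norm_integral_le_of_norm_le_const (a := 0) (b := 1) (C := 1)
    (f := fun s => (1 - s) * Real.exp (-x * s)) ?_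
  · simpa using this
  · intro s hs
    rw [Set.uIoc_of_le zero_le_one] at hs
    rw [Real.norm_eq_abs, abs_mul, abs_of_nonneg (by linarith [hs.2] : 0 ≤ 1 - s), Real.abs_exp]
    have h1 : Real.exp (-x * s) ≤ 1 := Real.exp_le_one_iff.2 (by nlinarith [hs.1])
    nlinarith [hs.1, hs.2, Real.exp_pos (-x * s)]

/-- `Φ` decreases at a linear rate on bounded subsets of `(0, ∞)`, so its inverse is Lipschitz
there. -/
lemma Phi_sub_ge {B x y : ℝ} (hx : 0 < x) (hxy : x ≤ y) (hyB : y ≤ B) :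
    Real.exp (-B) / 6 * (y - x) ≤ Phi x - Phi y := by
  have hc : ∀ a : ℝ, IntervalIntegrable (fun s => (1 - s) * Real.exp (-a * s)) volume 0 1 :=
    fun a => (by fun_prop :
      Continuous fun s : ℝ => (1 - s) * Real.exp (-a * s)).intervalIntegrable _ _
  rw [Phi_eq_integral hx.ne', Phi_eq_integral (hx.trans_le hxy).ne',
    ← intervalIntegral.integral_sub (hc x) (hc y)]
  have hI : ∫ s in (0 : ℝ)..1, (s - s ^ 2) * (Real.exp (-B) * (y - x)) =
      Real.exp (-B) / 6 * (y - x) := by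
    rw [intervalIntegral.integral_mul_const, intervalIntegral.integral_sub
      (by simp) (by simp)]
    simp only [integral_id, integral_pow]
    norm_num
    ring
  rw [← hI]
  refine intervalIntegral.integral_mono_on zero_le_one
    ((by fun_prop : Continuous fun s : ℝ =>
      (s - s ^ 2) * (Real.exp (-B) * (y - x))).intervalIntegrable _ _)
    ((hc x).sub (hc y)) ?_
  intro s hs
  have h1 : Real.exp (-y * s) * (1 + (y - x) * s) ≤ Real.exp (-x * s) := by
    have : Real.exp (-x * s) = Real.exp (-y * s) * Real.exp ((y - x) * s) := by
      rw [← Real.exp_add]; ring_nf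
    rw [this]
    gcongr
    linarith [Real.add_one_le_exp ((y - x) * s)]
  have h2 : Real.exp (-B) ≤ Real.exp (-y * s) := Real.exp_le_exp.2 (by nlinarith [hs.1, hs.2])
  have h3 : Real.exp (-B) * ((y - x) * s) ≤ Real.exp (-x * s) - Real.exp (-y * s) := by
    have := mul_le_mul_of_nonneg_right h2 (mul_nonneg (sub_nonneg.2 hxy) hs.1)
    linarith
  have := mul_le_mul_of_nonneg_left h3 (sub_nonneg.2 hs.2)
  linarith

lemma continuousOn_Phi : ContinuousOn Phi (Set.Ioi 0) := by
  unfold Phi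
  have h : ∀ x ∈ Set.Ioi (0 : ℝ), x ≠ 0 := fun x hx => (Set.mem_Ioi.1 hx).ne'
  exact (continuousOn_const.div continuousOn_id h).sub
    ((continuousOn_const.div (by fun_prop) fun x hx => pow_ne_zero 2 (h x hx)).mul (by fun_prop))

/-- The stationary mean of the telegraph process. -/
noncomputable def statMean (y : Fin 2 → ℝ) (lam mu : ℝ) : ℝ :=
  (mu * y 0 + lam * y 1) / (lam + mu)

/-- The stationary variance `(m - y₁)(y₂ - m)` of the telegraph process with mean `m`. -/
noncomputable def statVar (y : Fin 2 → ℝ) (lam mu : ℝ) : ℝ :=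
  lam * mu * (y 1 - y 0) ^ 2 / (lam + mu) ^ 2

/-- The second moment of the integral of the telegraph process over a unit time interval. -/
noncomputable def incrMoment (y : Fin 2 → ℝ) (lam mu : ℝ) : ℝ :=
  statMean y lam mu ^ 2 + 2 * statVar y lam mu * Phi (lam + mu)

lemma statVar_eq (y : Fin 2 → ℝ) {lam mu : ℝ} (h : lam + mu ≠ 0) :
    statVar y lam mu = (statMean y lam mu - y 0) * (y 1 - statMean y lam mu) := by
  unfold statVar statMean
  field_simp
  ring

lemma abs_statMean_le (y : Fin 2 → ℝ) {lam mu : ℝ} (hl : 0 < lam) (hm : 0 < mu) :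
    |statMean y lam mu| ≤ |y 0| + |y 1| := by
  unfold statMean
  rw [abs_div, abs_of_pos (add_pos hl hm), div_le_iff₀ (add_pos hl hm)]
  refine (abs_add_le _ _).trans ?_
  rw [abs_mul, abs_mul, abs_of_pos hl, abs_of_pos hm]
  nlinarith [abs_nonneg (y 0), abs_nonneg (y 1)]

/-- Stability of the moment equation `z = u² + 2 (u - y₀)(y₁ - u) Φ(a)` in the data `(u, z)`:
for data at distance `d` from the exact pair `(m, m² + 2 η Φ(b₀))`, with `d` small, there is a
root near `b₀`, and every root is at distance `O(d)` from `b₀`. -/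
lemma moment_root_stable {y₀ y₁ A B e ε d m u z b₀ : ℝ} (he : 0 < e) (hε : 0 < ε)
    (hA₀ : |y₀ + y₁| ≤ A) (hm : |m| ≤ A) (hη : e ≤ (m - y₀) * (y₁ - m))
    (hb₀ : ε < b₀) (hB : b₀ + ε ≤ B)
    (hu : |u - m| ≤ d) (hz : |z - (m ^ 2 + 2 * ((m - y₀) * (y₁ - m)) * Phi b₀)| ≤ d)
    (hd1 : d ≤ 1) (hd2 : d * (3 * A + 1) ≤ e / 2)
    (hd3 : d * (8 * A + 4) / e ≤ Real.exp (-B) / 6 * ε) :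
    (∃ a ∈ Set.Icc (b₀ - ε) (b₀ + ε), z = u ^ 2 + 2 * ((u - y₀) * (y₁ - u)) * Phi a) ∧
    ∀ b, 0 < b → b ≤ B → z = u ^ 2 + 2 * ((u - y₀) * (y₁ - u)) * Phi b →
      Real.exp (-B) / 6 * |b - b₀| ≤ d * (8 * A + 4) / e := by
  have hb₀pos : 0 < b₀ := hε.trans hb₀
  have hd0 : 0 ≤ d := (abs_nonneg _).trans hu
  have hA : 0 ≤ A := (abs_nonneg _).trans hm
  have hΦ : |Phi b₀| ≤ 1 := abs_Phi_le_one hb₀pos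
  have hum : |u + m| ≤ 2 * A + 1 := by
    have : u + m = (u - m) + 2 * m := by ring
    rw [this]
    refine (abs_add_le _ _).trans ?_
    rw [abs_mul, abs_two]
    linarith
  have hη' : |(u - y₀) * (y₁ - u) - (m - y₀) * (y₁ - m)| ≤ d * (3 * A + 1) := by
    have : (u - y₀) * (y₁ - u) - (m - y₀) * (y₁ - m) = (u - m) * ((y₀ + y₁) - (u + m)) := by ring
    rw [this, abs_mul]
    refine mul_le_mul hu ((abs_sub _ _).trans ?_) (abs_nonneg _) hd0
    linarith
  have hηpos : e / 2 ≤ (u - y₀) * (y₁ - u) := by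
    have := (abs_le.1 hη').1
    linarith
  have hR : |z - u ^ 2 - 2 * ((u - y₀) * (y₁ - u)) * Phi b₀| ≤ d * (8 * A + 4) := by
    have h1 : z - u ^ 2 - 2 * ((u - y₀) * (y₁ - u)) * Phi b₀ =
        (z - (m ^ 2 + 2 * ((m - y₀) * (y₁ - m)) * Phi b₀)) - (u - m) * (u + m)
          - 2 * ((u - y₀) * (y₁ - u) - (m - y₀) * (y₁ - m)) * Phi b₀ := by ring
    rw [h1]
    refine (abs_sub _ _).trans ?_
    have h2 : |(u - m) * (u + m)| ≤ d * (2 * A + 1) := by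
      rw [abs_mul]
      exact mul_le_mul hu hum (abs_nonneg _) hd0
    have h3 : |2 * ((u - y₀) * (y₁ - u) - (m - y₀) * (y₁ - m)) * Phi b₀| ≤
        2 * (d * (3 * A + 1)) * 1 := by
      rw [abs_mul, abs_mul, abs_two]
      gcongr
    have h4 := abs_sub (z - (m ^ 2 + 2 * ((m - y₀) * (y₁ - m)) * Phi b₀)) ((u - m) * (u + m))
    linarith
  set h := (u - y₀) * (y₁ - u) with hh
  have hh0 : 0 < h := by linarith
  set q := (z - u ^ 2) / (2 * h) with hq
  have hroot : ∀ a, z = u ^ 2 + 2 * h * Phi a ↔ Phi a = q := by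
    intro a
    rw [hq, eq_div_iff (by positivity)]
    constructor <;> intro H <;> linarith
  have hqb : |q - Phi b₀| ≤ d * (8 * A + 4) / e := by
    have : q - Phi b₀ = (z - u ^ 2 - 2 * h * Phi b₀) / (2 * h) := by
      rw [hq]; field_simp
    rw [this, abs_div, abs_of_pos (by positivity : 0 < 2 * h)]
    exact div_le_div₀ (by positivity) hR he (by linarith)
  have hqb' := abs_le.1 (hqb.trans hd3)
  constructor
  · have hlo := Phi_sub_ge (B := B) (x := b₀ - ε) (y := b₀) (by linarith) (by linarith)
      (by linarith)
    have hhi := Phi_sub_ge (B := B) (x := b₀) (y := b₀ + ε) (by linarith) (by linarith)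
      (by linarith)
    have hcont : ContinuousOn Phi (Set.Icc (b₀ - ε) (b₀ + ε)) :=
      continuousOn_Phi.mono fun a ha => by
        have := ha.1
        simp only [Set.mem_Ioi]
        linarith
    obtain ⟨a, ha, haq⟩ := intermediate_value_Icc' (by linarith) hcont
      (show q ∈ Set.Icc (Phi (b₀ + ε)) (Phi (b₀ - ε)) by
        constructor
        · ring_nf at hhi hqb' ⊢; linarith [hqb'.1]
        · ring_nf at hlo hqb' ⊢; linarith [hqb'.2])
    exact ⟨a, ha, (hroot a).2 haq⟩
  · intro b hb hbB hbr
    rw [hroot] at hbr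
    rw [← hbr] at hqb
    refine le_trans ?_ hqb
    rcases le_total b b₀ with hle | hle
    · rw [abs_of_nonpos (by linarith), neg_sub]
      exact (Phi_sub_ge hb hle (by linarith)).trans (le_abs_self _)
    · rw [abs_of_nonneg (by linarith), abs_sub_comm]
      exact (Phi_sub_ge hb₀pos hle hbB).trans (le_abs_self _)

/-- The pathwise error bound for `β_T`: it holds for every observed path, because `β_T` is
bounded and the right-hand side is bounded below when the empirical moments are not close to
the true ones. -/
lemma beta_error {y : Fin 2 → ℝ} {c₀ c₁ : ℝ} (hy : y 0 ≠ y 1) (hc₀ : 0 < c₀) (hc : c₀ < c₁)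
    {J : Set ℝ} (hJpos : J ⊆ Set.Ioi 0) (hJbdd : BddAbove J)
    {K : Set (ℝ × ℝ)} (hK : IsCompact K)
    (hKc : K ⊆ Set.Icc c₀ c₁ ×ˢ Set.Icc c₀ c₁)
    (hKJ : ∀ ϑ ∈ K, ϑ.1 + ϑ.2 ∈ interior J) :
    ∃ C : ℝ, 0 < C ∧ ∃ B : ℝ, ∀ (x : ℝ≥0 → ℝ) (T : ℕ), |beta y c₀ c₁ J x T| ≤ B ∧
      ∀ lam mu : ℝ, (lam, mu) ∈ K →
      (beta y c₀ c₁ J x T - (lam + mu)) ^ 2 ≤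
        C * ((mean x T - statMean y lam mu) ^ 2 + (zeta x T - incrMoment y lam mu) ^ 2) := by
  classical
  have hcompact : IsCompact ((fun ϑ : ℝ × ℝ => ϑ.1 + ϑ.2) '' K) := hK.image (by fun_prop)
  obtain ⟨ε, hε, hεJ⟩ := hcompact.exists_cthickening_subset_open isOpen_interior
    (by rintro _ ⟨ϑ, hϑ, rfl⟩; exact hKJ ϑ hϑ)
  have hball : ∀ lam mu : ℝ, (lam, mu) ∈ K →
      Set.Icc (lam + mu - ε) (lam + mu + ε) ⊆ J := by
    intro lam mu h a ha
    refine interior_subset (hεJ (Metric.mem_cthickening_of_dist_le a (lam + mu) ε _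
      ⟨(lam, mu), h, rfl⟩ ?_))
    rw [Real.dist_eq, abs_le]
    constructor <;> linarith [ha.1, ha.2]
  obtain ⟨b, hb⟩ := hJbdd
  -- a common bound for `J`, for the default value `c₀ + c₁`, and for `λ + μ`
  set B : ℝ := max b (2 * c₁) with hB
  have hBJ : ∀ a ∈ J, a ≤ B := fun a ha => (hb ha).trans (le_max_left _ _)
  have hBc : 2 * c₁ ≤ B := le_max_right _ _
  have hB0 : 0 < B := by linarith
  set A : ℝ := |y 0| + |y 1| with hA
  have hA0 : 0 ≤ A := by positivity
  -- a lower bound for the stationary variance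
  set e : ℝ := c₀ ^ 2 * (y 1 - y 0) ^ 2 / (2 * c₁) ^ 2 with he
  have hsub : y 1 - y 0 ≠ 0 := sub_ne_zero.2 hy.symm
  have hc₁ : 0 < c₁ := hc₀.trans hc
  have he0 : 0 < e := by positivity
  set κ : ℝ := Real.exp (-B) / 6 with hκ
  have hκ0 : 0 < κ := by positivity
  -- the distance of the moments below which the moment equation is well conditioned
  set δ : ℝ := min 1 (min (e / 2 / (3 * A + 1)) (κ * ε * e / (8 * A + 4))) with hδ
  have hδ0 : 0 < δ := by positivity
  set L : ℝ := (8 * A + 4) / (e * κ) with hL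
  have hbeta : ∀ x T, 0 < beta y c₀ c₁ J x T ∧ beta y c₀ c₁ J x T ≤ B := by
    intro x T
    unfold beta
    split_ifs with h
    · exact ⟨hJpos h.choose_spec.1, hBJ _ h.choose_spec.1⟩
    · exact ⟨by linarith, by linarith⟩
  refine ⟨2 * (L ^ 2 + B ^ 2 / δ ^ 2), by positivity, B, fun x T => ⟨?_, ?_⟩⟩
  · exact abs_le.2 ⟨by linarith [(hbeta x T).1], (hbeta x T).2⟩
  intro lam mu hϑ
  obtain ⟨⟨hl0, hl1⟩, hm0, hm1⟩ := hKc hϑ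
  simp only at hl0 hl1 hm0 hm1
  have hl : 0 < lam := by linarith
  have hm : 0 < mu := by linarith
  have hI := hball lam mu hϑ
  set d : ℝ := |mean x T - statMean y lam mu| + |zeta x T - incrMoment y lam mu| with hd
  have hd0 : 0 ≤ d := by positivity
  have hdsq : d ^ 2 ≤ 2 * ((mean x T - statMean y lam mu) ^ 2
      + (zeta x T - incrMoment y lam mu) ^ 2) := by
    rw [← sq_abs (mean x T - _), ← sq_abs (zeta x T - _), hd]
    nlinarith [sq_nonneg (|mean x T - statMean y lam mu| - |zeta x T - incrMoment y lam mu|)]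
  have hfin : (beta y c₀ c₁ J x T - (lam + mu)) ^ 2 ≤ (L ^ 2 + B ^ 2 / δ ^ 2) * d ^ 2 := by
    rcases le_or_gt d δ with hdδ | hdδ
    · have hv := statVar_eq y (add_pos hl hm).ne'
      have hde : e ≤ statVar y lam mu := by
        rw [he, statVar]
        have h1 : c₀ ^ 2 ≤ lam * mu := by nlinarith
        have h2 : (lam + mu) ^ 2 ≤ (2 * c₁) ^ 2 := by gcongr; linarith
        gcongr
      have h1 : d ≤ 1 := hdδ.trans (min_le_left _ _)
      have h2 : d * (3 * A + 1) ≤ e / 2 := by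
        rw [← le_div_iff₀ (by positivity)]
        exact hdδ.trans ((min_le_right _ _).trans (min_le_left _ _))
      have h3 : d * (8 * A + 4) / e ≤ κ * ε := by
        rw [div_le_iff₀ he0, ← le_div_iff₀ (by positivity)]
        exact hdδ.trans ((min_le_right _ _).trans (min_le_right _ _))
      have hlo : lam + mu - ε ∈ J := hI ⟨le_rfl, by linarith⟩
      have hhi : lam + mu + ε ∈ J := hI ⟨by linarith, le_rfl⟩
      have hlo' := hJpos hlo
      rw [Set.mem_Ioi] at hlo'
      obtain ⟨⟨a, ha, har⟩, huniq⟩ := moment_root_stable (y₀ := y 0) (y₁ := y 1) (A := A) (B := B)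
        (m := statMean y lam mu) (u := mean x T) (z := zeta x T) (b₀ := lam + mu)
        he0 hε (abs_add_le _ _) (abs_statMean_le y hl hm) (hv ▸ hde) (by linarith)
        (hBJ _ hhi) (by rw [hd]; linarith [abs_nonneg (zeta x T - incrMoment y lam mu)])
        (by
          rw [← hv]
          change |zeta x T - incrMoment y lam mu| ≤ d
          rw [hd]; linarith [abs_nonneg (mean x T - statMean y lam mu)]) h1 h2 h3
      have hex : ∃ a ∈ J, IsRoot y x T a := ⟨a, hI ha, har⟩
      have hspec : IsRoot y x T (beta y c₀ c₁ J x T) := by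
        unfold beta
        rw [dif_pos hex]
        exact hex.choose_spec.2
      have := huniq _ (hbeta x T).1 (hbeta x T).2 hspec
      have h4 : |beta y c₀ c₁ J x T - (lam + mu)| ≤ L * d := by
        rw [hL, div_mul_eq_mul_div, le_div_iff₀ (by positivity)]
        rw [le_div_iff₀ he0] at this
        rw [hκ]
        linarith
      have h5 := pow_le_pow_left₀ (abs_nonneg _) h4 2
      rw [sq_abs] at h5
      have h6 : 0 ≤ B ^ 2 / δ ^ 2 * d ^ 2 := by positivity
      linarith [mul_pow L d 2]
    · have h1 : |beta y c₀ c₁ J x T - (lam + mu)| ≤ B := by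
        rw [abs_le]
        constructor <;> linarith [(hbeta x T).1, (hbeta x T).2]
      have h2 := pow_le_pow_left₀ (abs_nonneg _) h1 2
      rw [sq_abs] at h2
      have h3 : B ^ 2 ≤ B ^ 2 / δ ^ 2 * d ^ 2 := by
        rw [div_mul_eq_mul_div, le_div_iff₀ (by positivity)]
        gcongr
      have h4 : 0 ≤ L ^ 2 * d ^ 2 := by positivity
      linarith
  calc _ ≤ _ := hfin
    _ ≤ (L ^ 2 + B ^ 2 / δ ^ 2) * (2 * ((mean x T - statMean y lam mu) ^ 2
      + (zeta x T - incrMoment y lam mu) ^ 2)) := by gcongr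
    _ = _ := by ring

/-! ### The law of the telegraph process -/

/-- The stationary distribution of the two-state chain. -/
noncomputable def statProb (lam mu : ℝ) : Fin 2 → ℝ := ![mu / (lam + mu), lam / (lam + mu)]

lemma statProb_nonneg {lam mu : ℝ} (hl : 0 < lam) (hm : 0 < mu) (i : Fin 2) :
    0 ≤ statProb lam mu i := by
  fin_cases i <;> simp [statProb] <;> positivity

lemma statProb_le_one {lam mu : ℝ} (hl : 0 < lam) (hm : 0 < mu) (i : Fin 2) :
    statProb lam mu i ≤ 1 := by
  fin_cases i <;> simp [statProb] <;> rw [div_le_one (by positivity)] <;> linarith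

/-- The semigroup in closed form: it converges to the stationary distribution at the exponential
rate `λ + μ`. -/
lemma transition_eq {lam mu : ℝ} (h : lam + mu ≠ 0) (t : ℝ≥0) (i j : Fin 2) :
    transition lam mu t i j = statProb lam mu j +
      Real.exp (-(lam + mu) * t) * ((if i = j then 1 else 0) - statProb lam mu j) := by
  -- the eigenvectors of the rate matrix, for the eigenvalues `0` and `-(λ + μ)`
  let U : (Matrix (Fin 2) (Fin 2) ℝ)ˣ :=
    ⟨!![1, lam; 1, -mu], !![mu / (lam + mu), lam / (lam + mu); 1 / (lam + mu), -1 / (lam + mu)],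
      by ext i j; fin_cases i <;> fin_cases j <;> simp [Matrix.mul_apply, Fin.sum_univ_two] <;>
          field_simp <;> ring,
      by ext i j; fin_cases i <;> fin_cases j <;> simp [Matrix.mul_apply, Fin.sum_univ_two] <;>
          field_simp <;> ring⟩
  have hdiag : ∀ a b : ℝ, Matrix.diagonal ![a, b] = !![a, 0; 0, b] := by
    intro a b
    ext i j
    fin_cases i <;> fin_cases j <;> rfl
  have hQ : (t : ℝ) • rateMatrix lam mu =
      U.val * Matrix.diagonal ![0, -(lam + mu) * t] * (U⁻¹).val := by
    change _ = !![1, lam; 1, -mu] * _ *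
      !![mu / (lam + mu), lam / (lam + mu); 1 / (lam + mu), -1 / (lam + mu)]
    rw [hdiag]
    ext i j
    fin_cases i <;> fin_cases j <;>
      simp [rateMatrix, Matrix.mul_apply, Fin.sum_univ_two] <;> field_simp <;> ring
  have hexp : (NormedSpace.exp ![0, -(lam + mu) * t] : Fin 2 → ℝ) =
      ![1, Real.exp (-(lam + mu) * t)] := by
    ext i
    rw [Pi.coe_exp, ← Real.exp_eq_exp_ℝ]
    fin_cases i <;> simp
  unfold transition
  rw [hQ, Matrix.exp_units_conj, Matrix.exp_diagonal, hexp, hdiag]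
  change ((!![1, lam; 1, -mu] * !![1, 0; 0, Real.exp (-(lam + mu) * t)] *
      !![mu / (lam + mu), lam / (lam + mu); 1 / (lam + mu), -1 / (lam + mu)] :
      Matrix (Fin 2) (Fin 2) ℝ)) i j = _
  fin_cases i <;> fin_cases j <;>
    simp [statProb, Matrix.mul_apply, Fin.sum_univ_two] <;> field_simp <;> ring

lemma transition_nonneg {lam mu : ℝ} (hl : 0 < lam) (hm : 0 < mu) (t : ℝ≥0) (i j : Fin 2) :
    0 ≤ transition lam mu t i j := by
  rw [transition_eq (add_pos hl hm).ne']
  have h1 : Real.exp (-(lam + mu) * t) ≤ 1 :=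
    Real.exp_le_one_iff.2 (by nlinarith [t.2, add_pos hl hm])
  have h2 := Real.exp_pos (-(lam + mu) * t)
  have h3 := statProb_nonneg hl hm j
  split_ifs <;> nlinarith

lemma transition_sum {lam mu : ℝ} (h : lam + mu ≠ 0) (t : ℝ≥0) (i : Fin 2) :
    ∑ j, transition lam mu t i j = 1 := by
  simp only [transition_eq h, Fin.sum_univ_two]
  fin_cases i <;> simp [statProb] <;> field_simp <;> ring

lemma transition_le_one {lam mu : ℝ} (hl : 0 < lam) (hm : 0 < mu) (t : ℝ≥0) (i j : Fin 2) :
    transition lam mu t i j ≤ 1 := by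
  rw [← transition_sum (add_pos hl hm).ne' t i]
  exact Finset.single_le_sum (f := fun j => transition lam mu t i j)
    (fun j _ => transition_nonneg hl hm t i j) (Finset.mem_univ j)

lemma abs_transition_sub_le {lam mu : ℝ} (hl : 0 < lam) (hm : 0 < mu) (t : ℝ≥0) (i j : Fin 2) :
    |transition lam mu t i j - statProb lam mu j| ≤ Real.exp (-(lam + mu) * t) := by
  rw [transition_eq (add_pos hl hm).ne', add_sub_cancel_left, abs_mul, Real.abs_exp]
  have h1 := statProb_nonneg hl hm j
  have h2 := statProb_le_one hl hm j
  refine mul_le_of_le_one_right (Real.exp_pos _).le (abs_le.2 ?_)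
  split_ifs <;> constructor <;> linarith

section Telegraph

variable {Ω : Type*} [MeasurableSpace Ω] {P : Measure Ω} {y : Fin 2 → ℝ} {lam mu : ℝ}
  {Y : ℝ≥0 → Ω → ℝ}

lemma IsTelegraph.measurableSet_eq (hY : IsTelegraph P y lam mu Y) (t : ℝ≥0) (i : Fin 2) :
    MeasurableSet {ω | Y t ω = y i} := hY.measurable t (measurableSet_singleton _)

lemma IsTelegraph.sum_prob [IsProbabilityMeasure P] (hY : IsTelegraph P y lam mu Y)
    (hy : Function.Injective y) (t : ℝ≥0) : ∑ i, P.real {ω | Y t ω = y i} = 1 := by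
  have hdis : Disjoint {ω | Y t ω = y 0} {ω | Y t ω = y 1} := by
    rw [Set.disjoint_left]
    intro ω h0 h1
    have : y 0 = y 1 := (Eq.symm h0).trans h1
    exact absurd (hy this) (by decide)
  rw [Fin.sum_univ_two, ← measureReal_union hdis (hY.measurableSet_eq t 1)]
  convert probReal_univ (μ := P)
  ext ω
  obtain ⟨i, hi⟩ := hY.two_state t ω
  fin_cases i <;> simp_all

/-- Stationarity forces the one-dimensional marginals to be the invariant distribution: a
distribution fixed by the semigroup at one positive time is `statProb`. -/
lemma IsTelegraph.prob_eq [IsProbabilityMeasure P] (hY : IsTelegraph P y lam mu Y)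
    (hy : Function.Injective y) (hl : 0 < lam) (hm : 0 < mu) (t : ℝ≥0) (j : Fin 2) :
    P.real {ω | Y t ω = y j} = statProb lam mu j := by
  have hshift : ∀ h : ℝ≥0, P.real {ω | Y h ω = y j} = P.real {ω | Y 0 ω = y j} := by
    intro h
    have hms : MeasurableSet {x : ℝ≥0 → ℝ | x 0 = y j} :=
      measurable_pi_apply 0 (measurableSet_singleton _)
    have h1 := congrArg (fun ν => ν.real {x : ℝ≥0 → ℝ | x 0 = y j}) (hY.stationary h)
    beta_reduce at h1
    rw [map_measureReal_apply (measurable_pi_lambda _ fun t => hY.measurable _) hms,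
      map_measureReal_apply (measurable_pi_lambda _ fun t => hY.measurable _) hms] at h1
    simpa using h1
  rw [hshift t]
  have hstep : P.real {ω | Y 1 ω = y j} =
      ∑ i, P.real {ω | Y 0 ω = y i} * transition lam mu 1 i j := by
    have hpair : ∀ i, P.real {ω | Y 0 ω = y i ∧ Y 1 ω = y j} =
        P.real {ω | Y 0 ω = y i} * transition lam mu 1 i j := by
      intro i
      have := hY.markov 1 ![0, 1] (by
        rw [Fin.monotone_iff_le_succ]; intro k; fin_cases k; simp) ![i, j]
      simpa [Fin.forall_fin_two] using this
    simp only [← hpair]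
    have hdis : Disjoint {ω | Y 0 ω = y 0 ∧ Y 1 ω = y j} {ω | Y 0 ω = y 1 ∧ Y 1 ω = y j} := by
      rw [Set.disjoint_left]
      rintro ω ⟨h0, -⟩ ⟨h1, -⟩
      exact absurd (hy (h0.symm.trans h1)) (by decide)
    rw [Fin.sum_univ_two, ← measureReal_union hdis
      ((hY.measurableSet_eq 0 1).inter (hY.measurableSet_eq 1 j))]
    congr 1
    ext ω
    obtain ⟨i, hi⟩ := hY.two_state 0 ω
    fin_cases i <;> simp_all
  rw [hshift 1] at hstep
  have hsum := hY.sum_prob hy 0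
  simp only [transition_eq (add_pos hl hm).ne', mul_add, Finset.sum_add_distrib,
    ← Finset.sum_mul, hsum] at hstep
  have hE : Real.exp (-(lam + mu) * (1 : ℝ≥0)) < 1 :=
    Real.exp_lt_one_iff.2 (by push_cast; linarith)
  simp only [mul_left_comm, ← Finset.mul_sum, mul_sub, Finset.sum_sub_distrib,
    ← Finset.sum_mul, hsum, mul_ite, mul_one, mul_zero, Finset.sum_ite_eq', Finset.mem_univ,
    if_true, one_mul] at hstep
  have : (1 - Real.exp (-(lam + mu) * (1 : ℝ≥0))) *
      (P.real {ω | Y 0 ω = y j} - statProb lam mu j) = 0 := by linarith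
  rcases mul_eq_zero.1 this with h | h <;> linarith

/-- The four-dimensional laws of the stationary telegraph process. -/
lemma IsTelegraph.integral_four [IsProbabilityMeasure P] (hY : IsTelegraph P y lam mu Y)
    (hy : Function.Injective y) (hl : 0 < lam) (hm : 0 < mu) (F G : ℝ → ℝ → ℝ)
    {s t u v : ℝ≥0} (hst : s ≤ t) (htu : t ≤ u) (huv : u ≤ v) :
    ∫ ω, F (Y s ω) (Y t ω) * G (Y u ω) (Y v ω) ∂P = ∑ i, ∑ j, ∑ k, ∑ l,
      F (y i) (y j) * G (y k) (y l) * (statProb lam mu i * transition lam mu (t - s) i j *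
        transition lam mu (u - t) j k * transition lam mu (v - u) k l) := by
  have hset : ∀ i j k l, MeasurableSet
      {ω | Y s ω = y i ∧ Y t ω = y j ∧ Y u ω = y k ∧ Y v ω = y l} := fun i j k l =>
    (hY.measurableSet_eq s i).inter ((hY.measurableSet_eq t j).inter
      ((hY.measurableSet_eq u k).inter (hY.measurableSet_eq v l)))
  have hpt : ∀ ω, F (Y s ω) (Y t ω) * G (Y u ω) (Y v ω) = ∑ i, ∑ j, ∑ k, ∑ l,
      {ω | Y s ω = y i ∧ Y t ω = y j ∧ Y u ω = y k ∧ Y v ω = y l}.indicator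
        (fun _ => F (y i) (y j) * G (y k) (y l)) ω := by
    intro ω
    obtain ⟨i, hi⟩ := hY.two_state s ω
    obtain ⟨j, hj⟩ := hY.two_state t ω
    obtain ⟨k, hk⟩ := hY.two_state u ω
    obtain ⟨l, hl⟩ := hY.two_state v ω
    simp only [Set.indicator_apply, Set.mem_ofPred_eq, hi, hj, hk, hl, hy.eq_iff, ite_and]
    simp
  have hint : ∀ i j k l, Integrable
      ({ω | Y s ω = y i ∧ Y t ω = y j ∧ Y u ω = y k ∧ Y v ω = y l}.indicator
        (fun _ => F (y i) (y j) * G (y k) (y l))) P := fun i j k l =>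
    (integrable_const _).indicator (hset i j k l)
  simp_rw [hpt]
  rw [integral_finsetSum _ fun i _ => integrable_finsetSum _ fun j _ =>
    integrable_finsetSum _ fun k _ => integrable_finsetSum _ fun l _ => hint i j k l]
  refine Finset.sum_congr rfl fun i _ => ?_
  rw [integral_finsetSum _ fun j _ =>
    integrable_finsetSum _ fun k _ => integrable_finsetSum _ fun l _ => hint i j k l]
  refine Finset.sum_congr rfl fun j _ => ?_
  rw [integral_finsetSum _ fun k _ => integrable_finsetSum _ fun l _ => hint i j k l]
  refine Finset.sum_congr rfl fun k _ => ?_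
  rw [integral_finsetSum _ fun l _ => hint i j k l]
  refine Finset.sum_congr rfl fun l _ => ?_
  rw [integral_indicator_const _ (hset i j k l), smul_eq_mul, mul_comm]
  congr 1
  have := hY.markov 3 ![s, t, u, v] (by
    rw [Fin.monotone_iff_le_succ]; intro n; fin_cases n <;> simpa) ![i, j, k, l]
  simp only [Fin.forall_fin_succ, Fin.prod_univ_succ] at this
  simp at this
  rw [this, hY.prob_eq hy hl hm]
  ring_nf

lemma IsTelegraph.integral_two [IsProbabilityMeasure P] (hY : IsTelegraph P y lam mu Y)
    (hy : Function.Injective y) (hl : 0 < lam) (hm : 0 < mu) (F : ℝ → ℝ → ℝ)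
    {s t : ℝ≥0} (hst : s ≤ t) :
    ∫ ω, F (Y s ω) (Y t ω) ∂P = ∑ i, ∑ j,
      F (y i) (y j) * (statProb lam mu i * transition lam mu (t - s) i j) := by
  have := hY.integral_four hy hl hm F (fun _ _ => 1) hst le_rfl (le_refl t)
  simp only [mul_one] at this
  rw [this]
  refine Finset.sum_congr rfl fun i _ => Finset.sum_congr rfl fun j _ => ?_
  simp only [← Finset.mul_sum, transition_sum (add_pos hl hm).ne', mul_one]

lemma IsTelegraph.integral_one [IsProbabilityMeasure P] (hY : IsTelegraph P y lam mu Y)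
    (hy : Function.Injective y) (hl : 0 < lam) (hm : 0 < mu) (t : ℝ≥0) :
    ∫ ω, Y t ω ∂P = statMean y lam mu := by
  rw [hY.integral_two hy hl hm (fun a _ => a) (le_refl t)]
  simp only [← Finset.mul_sum, transition_sum (add_pos hl hm).ne', mul_one]
  simp [statProb, statMean]
  ring

lemma IsTelegraph.integral_mul [IsProbabilityMeasure P] (hY : IsTelegraph P y lam mu Y)
    (hy : Function.Injective y) (hl : 0 < lam) (hm : 0 < mu) (s t : ℝ≥0) :
    ∫ ω, Y s ω * Y t ω ∂P = statMean y lam mu ^ 2 +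
      statVar y lam mu * Real.exp (-(lam + mu) * |(s : ℝ) - t|) := by
  wlog hst : s ≤ t generalizing s t
  · rw [abs_sub_comm, ← this t s (le_of_not_ge hst)]
    simp only [mul_comm]
  have hne := (add_pos hl hm).ne'
  rw [hY.integral_two hy hl hm (fun a b => a * b) hst, abs_sub_comm,
    abs_of_nonneg (sub_nonneg.2 (NNReal.coe_le_coe.2 hst))]
  simp only [transition_eq hne, NNReal.coe_sub hst, Fin.sum_univ_two]
  simp [statProb, statMean, statVar]
  field_simp
  ring

/-- Exponential decay of covariances: functionals of the pairs of times `{s, t}` and `{u, v}`, the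
second pair later than the first by at least `d`, decorrelate at rate `exp (-(λ + μ) d)`. The
factor `16` counts the paths of the chain through four times. -/
lemma IsTelegraph.abs_cov_le [IsProbabilityMeasure P] (hY : IsTelegraph P y lam mu Y)
    (hy : Function.Injective y) (hl : 0 < lam) (hm : 0 < mu) {F G : ℝ → ℝ → ℝ} {D d : ℝ}
    (hF : ∀ i j, |F (y i) (y j)| ≤ D) (hG : ∀ i j, |G (y i) (y j)| ≤ D)
    {s t u v : ℝ≥0} (hsu : (s : ℝ) + d ≤ u) (hsv : (s : ℝ) + d ≤ v)
    (htu : (t : ℝ) + d ≤ u) (htv : (t : ℝ) + d ≤ v) (hd : 0 ≤ d) :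
    |∫ ω, F (Y s ω) (Y t ω) * G (Y u ω) (Y v ω) ∂P -
      (∫ ω, F (Y s ω) (Y t ω) ∂P) * ∫ ω, G (Y u ω) (Y v ω) ∂P| ≤
        16 * (D ^ 2 * Real.exp (-(lam + mu) * d)) := by
  wlog hst : s ≤ t generalizing s t F
  · exact this (F := fun a b => F b a) (fun i j => hF j i) htu htv hsu hsv (le_of_not_ge hst)
  wlog huv : u ≤ v generalizing u v G
  · exact this (G := fun a b => G b a) (fun i j => hG j i) hsv hsu htv htu (le_of_not_ge huv)
  have htu' : t ≤ u := NNReal.coe_le_coe.1 (by linarith)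
  have hD : 0 ≤ D := (abs_nonneg _).trans (hF 0 0)
  rw [hY.integral_four hy hl hm F G hst htu' huv, hY.integral_two hy hl hm F hst,
    hY.integral_two hy hl hm G huv]
  have hdecay : ∀ j k, |transition lam mu (u - t) j k - statProb lam mu k| ≤
      Real.exp (-(lam + mu) * d) := by
    intro j k
    refine (abs_transition_sub_le hl hm _ j k).trans (Real.exp_le_exp.2 ?_)
    rw [NNReal.coe_sub htu']
    nlinarith [add_pos hl hm]
  have hdiff : (∑ i, ∑ j, ∑ k, ∑ l,
      F (y i) (y j) * G (y k) (y l) * (statProb lam mu i * transition lam mu (t - s) i j *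
        transition lam mu (u - t) j k * transition lam mu (v - u) k l)) -
      (∑ i, ∑ j, F (y i) (y j) * (statProb lam mu i * transition lam mu (t - s) i j)) *
      (∑ k, ∑ l, G (y k) (y l) * (statProb lam mu k * transition lam mu (v - u) k l)) =
      ∑ i, ∑ j, ∑ k, ∑ l,
      F (y i) (y j) * G (y k) (y l) * (statProb lam mu i * transition lam mu (t - s) i j *
        (transition lam mu (u - t) j k - statProb lam mu k) *
          transition lam mu (v - u) k l) := by
    simp_rw [Finset.sum_mul, Finset.mul_sum]
    simp only [← Finset.sum_sub_distrib]
    refine Finset.sum_congr rfl fun i _ => Finset.sum_congr rfl fun j _ =>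
      Finset.sum_congr rfl fun k _ => Finset.sum_congr rfl fun l _ => ?_
    ring
  rw [hdiff]
  have hterm : ∀ i j k l, |F (y i) (y j) * G (y k) (y l) *
      (statProb lam mu i * transition lam mu (t - s) i j *
        (transition lam mu (u - t) j k - statProb lam mu k) * transition lam mu (v - u) k l)| ≤
      D ^ 2 * Real.exp (-(lam + mu) * d) := by
    intro i j k l
    simp only [abs_mul, abs_of_nonneg (statProb_nonneg hl hm i),
      abs_of_nonneg (transition_nonneg hl hm _ _ _)]
    have h1 : |F (y i) (y j)| * |G (y k) (y l)| ≤ D ^ 2 := by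
      rw [sq]
      exact mul_le_mul (hF i j) (hG k l) (abs_nonneg _) hD
    have h2 : statProb lam mu i * transition lam mu (t - s) i j *
        |transition lam mu (u - t) j k - statProb lam mu k| * transition lam mu (v - u) k l ≤
        1 * 1 * Real.exp (-(lam + mu) * d) * 1 := by
      have := statProb_nonneg hl hm i
      have := transition_nonneg hl hm (t - s) i j
      have := transition_nonneg hl hm (v - u) k l
      gcongr
      · exact statProb_le_one hl hm i
      · exact transition_le_one hl hm _ _ _
      · exact hdecay j k
      · exact transition_le_one hl hm _ _ _
    have h3 : 0 ≤ statProb lam mu i * transition lam mu (t - s) i j *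
        |transition lam mu (u - t) j k - statProb lam mu k| * transition lam mu (v - u) k l := by
      have := statProb_nonneg hl hm i
      have := transition_nonneg hl hm (t - s) i j
      have := transition_nonneg hl hm (v - u) k l
      positivity
    have h4 := mul_le_mul h1 h2 h3 (by positivity)
    linarith
  calc _ ≤ ∑ i : Fin 2, ∑ j : Fin 2, ∑ k : Fin 2, ∑ l : Fin 2,
        D ^ 2 * Real.exp (-(lam + mu) * d) := by
        refine (Finset.abs_sum_le_sum_abs _ _).trans (Finset.sum_le_sum fun i _ => ?_)
        refine (Finset.abs_sum_le_sum_abs _ _).trans (Finset.sum_le_sum fun j _ => ?_)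
        refine (Finset.abs_sum_le_sum_abs _ _).trans (Finset.sum_le_sum fun k _ => ?_)
        exact (Finset.abs_sum_le_sum_abs _ _).trans (Finset.sum_le_sum fun l _ => hterm i j k l)
    _ = _ := by simp; ring

end Telegraph

/-! ### Joint measurability and averages over time -/

open scoped unitInterval Topology

/-- A process with right-continuous paths is jointly measurable: it is the limit of its values at
the grid times `(⌊(n + 1) t⌋ + 1) / (n + 1)`, which tend to `t` from the right. -/
lemma measurable_uncurry_of_rightContinuous {Ω : Type*} {mΩ : MeasurableSpace Ω}
    {Y : ℝ≥0 → Ω → ℝ} (hm : ∀ t, Measurable (Y t))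
    (hr : ∀ ω t, ContinuousWithinAt (fun s => Y s ω) (Set.Ici t) t) :
    Measurable (fun p : ℝ≥0 × Ω => Y p.1 p.2) := by
  let τ : ℕ → ℝ≥0 → ℝ≥0 := fun n t => (⌊((n : ℝ≥0) + 1) * t⌋₊ + 1 : ℝ≥0) / (n + 1)
  have hτge : ∀ n t, t ≤ τ n t := by
    intro n t
    rw [le_div_iff₀ (by positivity), mul_comm]
    exact (Nat.lt_floor_add_one _).le
  have hτle : ∀ n t, τ n t ≤ t + 1 / (n + 1) := by
    intro n t
    have hn : (n : ℝ≥0) + 1 ≠ 0 := by positivity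
    rw [div_le_iff₀ (by positivity), add_mul t, one_div, inv_mul_cancel₀ hn, mul_comm t]
    gcongr
    exact Nat.floor_le (by positivity)
  have hτlim : ∀ t, Filter.Tendsto (fun n => τ n t) Filter.atTop (𝓝 t) := by
    intro t
    refine tendsto_of_tendsto_of_tendsto_of_le_of_le tendsto_const_nhds ?_
      (fun n => hτge n t) (fun n => hτle n t)
    have : Filter.Tendsto (fun n : ℕ => (1 : ℝ≥0) / (n + 1)) Filter.atTop (𝓝 0) :=
      tendsto_one_div_add_atTop_nhds_zero_nat (𝕜 := ℝ≥0)
    simpa using this.const_add t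
  refine measurable_of_tendsto_metrizable (f := fun n (p : ℝ≥0 × Ω) => Y (τ n p.1) p.2) ?_ ?_
  · intro n
    have h1 : ∀ (ρ : ℕ → ℝ≥0) (φ : ℝ≥0 → ℕ), Measurable φ →
        Measurable (fun p : ℝ≥0 × Ω => Y (ρ (φ p.1)) p.2) := by
      intro ρ φ hφ
      have h2 : Measurable (fun q : ℕ × Ω => Y (ρ q.1) q.2) :=
        measurable_from_prod_countable_right fun k => hm (ρ k)
      exact h2.comp ((hφ.comp measurable_fst).prodMk measurable_snd)
    exact h1 (fun k => ((k : ℝ≥0) + 1) / (n + 1)) (fun t => ⌊((n : ℝ≥0) + 1) * t⌋₊)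
      (Nat.measurable_floor.comp (by fun_prop))
  · rw [tendsto_pi_nhds]
    rintro ⟨t, ω⟩
    exact (hr ω t).tendsto.comp (tendsto_nhdsWithin_iff.2
      ⟨hτlim t, Filter.Eventually.of_forall fun n => hτge n t⟩)

/-- A covariance bound that is uniform over two parameters passes to the averages over these
parameters. -/
lemma abs_cov_integral_le {Ω S : Type*} [MeasurableSpace Ω] [MeasurableSpace S] {P : Measure Ω}
    [IsProbabilityMeasure P] {ν : Measure S} [IsProbabilityMeasure ν] {H G : S → Ω → ℝ} {D c : ℝ}
    (hH : Measurable (fun p : S × Ω => H p.1 p.2)) (hG : Measurable (fun p : S × Ω => G p.1 p.2))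
    (hHD : ∀ p ω, |H p ω| ≤ D) (hGD : ∀ p ω, |G p ω| ≤ D)
    (hc : ∀ p q, |∫ ω, H p ω * G q ω ∂P - (∫ ω, H p ω ∂P) * ∫ ω, G q ω ∂P| ≤ c) :
    |∫ ω, (∫ p, H p ω ∂ν) * (∫ p, G p ω ∂ν) ∂P -
      (∫ ω, ∫ p, H p ω ∂ν ∂P) * ∫ ω, ∫ p, G p ω ∂ν ∂P| ≤ c := by
  have hprodM : Measurable (fun r : Ω × (S × S) => H r.2.1 r.1 * G r.2.2 r.1) :=
    (hH.comp (by fun_prop : Measurable fun r : Ω × (S × S) => (r.2.1, r.1))).mul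
      (hG.comp (by fun_prop : Measurable fun r : Ω × (S × S) => (r.2.2, r.1)))
  have hprodI : Integrable (fun r : Ω × (S × S) => H r.2.1 r.1 * G r.2.2 r.1)
      (P.prod (ν.prod ν)) := by
    refine Integrable.of_bound hprodM.aestronglyMeasurable (D * D)
      (Filter.Eventually.of_forall fun r => ?_)
    rw [Real.norm_eq_abs, abs_mul]
    exact mul_le_mul (hHD _ _) (hGD _ _) (abs_nonneg _) ((abs_nonneg _).trans (hHD r.2.1 r.1))
  have hswap : ∀ {H : S → Ω → ℝ}, Measurable (fun p : S × Ω => H p.1 p.2) →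
      (∀ p ω, |H p ω| ≤ D) → Integrable (fun r : Ω × S => H r.2 r.1) (P.prod ν) := by
    intro H hH hHD
    exact Integrable.of_bound (hH.comp measurable_swap).aestronglyMeasurable D
      (Filter.Eventually.of_forall fun r => hHD _ _)
  have h1 : ∫ ω, (∫ p, H p ω ∂ν) * (∫ p, G p ω ∂ν) ∂P =
      ∫ r : S × S, (∫ ω, H r.1 ω * G r.2 ω ∂P) ∂(ν.prod ν) := by
    simp_rw [← integral_prod_mul]
    exact integral_integral_swap hprodI
  have h2 : (∫ ω, ∫ p, H p ω ∂ν ∂P) * ∫ ω, ∫ p, G p ω ∂ν ∂P =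
      ∫ r : S × S, (∫ ω, H r.1 ω ∂P) * (∫ ω, G r.2 ω ∂P) ∂(ν.prod ν) := by
    rw [integral_integral_swap (f := fun ω p => H p ω) (hswap hH hHD),
      integral_integral_swap (f := fun ω p => G p ω) (hswap hG hGD),
      ← integral_prod_mul (fun p => ∫ ω, H p ω ∂P)]
  rw [h1, h2, ← integral_sub hprodI.integral_prod_right
    ((hswap hH hHD).integral_prod_right.mul_prod (hswap hG hGD).integral_prod_right)]
  have := norm_integral_le_of_norm_le_const (μ := ν.prod ν)
    (f := fun r : S × S => ∫ ω, H r.1 ω * G r.2 ω ∂P - (∫ ω, H r.1 ω ∂P) * ∫ ω, G r.2 ω ∂P)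
    (C := c) (Filter.Eventually.of_forall fun r => hc r.1 r.2)
  simpa using this

lemma integral_unitInterval (f : ℝ → ℝ) : ∫ x : I, f x = ∫ x in (0 : ℝ)..1, f x := by
  rw [intervalIntegral.integral_of_le zero_le_one, ← integral_Icc_eq_integral_Ioc]
  exact unitInterval.measurePreserving_coe.integral_comp unitInterval.measurableEmbedding_coe f

lemma integral_exp_neg_abs_sub {b s : ℝ} (hb : b ≠ 0) (hs : s ∈ Set.Icc (0 : ℝ) 1) :
    ∫ u in (0 : ℝ)..1, Real.exp (-b * |s - u|) =
      (2 - Real.exp (-b * s) - Real.exp (-b * (1 - s))) / b := by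
  have hc : Continuous fun u : ℝ => Real.exp (-b * |s - u|) := by fun_prop
  rw [← intervalIntegral.integral_add_adjacent_intervals (hc.intervalIntegrable 0 s)
    (hc.intervalIntegrable s 1)]
  have h1 : ∫ u in (0 : ℝ)..s, Real.exp (-b * |s - u|) =
      ∫ u in (0 : ℝ)..s, Real.exp (b * u) * Real.exp (-b * s) := by
    refine intervalIntegral.integral_congr fun u hu => ?_
    rw [Set.uIcc_of_le hs.1] at hu
    rw [abs_of_nonneg (sub_nonneg.2 hu.2), ← Real.exp_add]
    ring_nf
  have h2 : ∫ u in s..1, Real.exp (-b * |s - u|) =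
      ∫ u in s..1, Real.exp (-b * u) * Real.exp (b * s) := by
    refine intervalIntegral.integral_congr fun u hu => ?_
    rw [Set.uIcc_of_le hs.2] at hu
    rw [abs_of_nonpos (sub_nonpos.2 hu.1), ← Real.exp_add]
    ring_nf
  have h3 : ∀ c : ℝ, c ≠ 0 → ∀ p q : ℝ, ∫ u in p..q, Real.exp (c * u) =
      (Real.exp (c * q) - Real.exp (c * p)) / c := by
    intro c hc p q
    rw [intervalIntegral.integral_comp_mul_left (fun u => Real.exp u) hc, integral_exp,
      smul_eq_mul]
    field_simp
  rw [h1, h2, intervalIntegral.integral_mul_const, intervalIntegral.integral_mul_const,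
    h3 b hb, h3 (-b) (neg_ne_zero.2 hb), div_mul_eq_mul_div, div_mul_eq_mul_div, sub_mul, sub_mul,
    ← Real.exp_add, ← Real.exp_add, ← Real.exp_add, ← Real.exp_add]
  have e1 : b * s + -b * s = 0 := by ring
  have e2 : b * 0 + -b * s = -b * s := by ring
  have e3 : -b * 1 + b * s = -b * (1 - s) := by ring
  have e4 : -b * s + b * s = 0 := by ring
  rw [e1, e2, e3, e4, Real.exp_zero]
  field_simp
  ring

/-- `Φ` arises as the average of the exponential correlation over the unit square. -/
lemma integral_square_exp {b : ℝ} (hb : b ≠ 0) :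
    ∫ p : I × I, Real.exp (-b * |(p.1 : ℝ) - p.2|) = 2 * Phi b := by
  have hint : Integrable (fun p : I × I => Real.exp (-b * |(p.1 : ℝ) - p.2|)) :=
    (by fun_prop : Continuous fun p : I × I =>
      Real.exp (-b * |(p.1 : ℝ) - p.2|)).integrable_of_hasCompactSupport
        (HasCompactSupport.of_compactSpace _)
  rw [show (volume : Measure (I × I)) = (volume : Measure I).prod volume from rfl] at hint ⊢
  rw [integral_prod _ hint]
  simp only
  have hin : ∀ x : I, ∫ u : I, Real.exp (-b * |(x : ℝ) - u|) =
      (2 - Real.exp (-b * x) - Real.exp (-b * (1 - x))) / b := fun x => by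
    rw [integral_unitInterval (fun u => Real.exp (-b * |(x : ℝ) - u|)),
      integral_exp_neg_abs_sub hb x.2]
  simp_rw [hin]
  rw [integral_unitInterval (fun x => (2 - Real.exp (-b * x) - Real.exp (-b * (1 - x))) / b)]
  have hd : ∀ s ∈ Set.uIcc (0 : ℝ) 1, HasDerivAt
      (fun s => (2 * s + Real.exp (-b * s) / b - Real.exp (-b * (1 - s)) / b) / b)
      ((2 - Real.exp (-b * s) - Real.exp (-b * (1 - s))) / b) s := by
    intro s _
    have h1 : HasDerivAt (fun s : ℝ => Real.exp (-b * s)) (Real.exp (-b * s) * (-b)) s := by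
      simpa using ((hasDerivAt_id s).const_mul (-b)).exp
    have h2 : HasDerivAt (fun s : ℝ => Real.exp (-b * (1 - s)))
        (Real.exp (-b * (1 - s)) * b) s := by
      simpa using (((hasDerivAt_id s).const_sub 1).const_mul (-b)).exp
    have h3 : HasDerivAt (fun s : ℝ => 2 * s) 2 s := by
      simpa using (hasDerivAt_id s).const_mul 2
    refine (((h3.add (h1.div_const b)).sub (h2.div_const b)).div_const b).congr_deriv ?_
    field_simp
    ring
  rw [intervalIntegral.integral_eq_sub_of_hasDerivAt hd
    ((by fun_prop : Continuous fun s : ℝ =>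
      (2 - Real.exp (-b * s) - Real.exp (-b * (1 - s))) / b).intervalIntegrable _ _)]
  simp only [Phi, mul_one, mul_zero, sub_zero, sub_self, Real.exp_zero]
  field_simp
  ring

/-! ### Averages over unit squares and their fluctuations -/

/-- The average `∫ F(Y(s), Y(t)) ds dt` over the square `[k, k + 1]²`. Both the increment
`∫ Y(s) ds` over `[k, k + 1]` and its square are of this form. -/
noncomputable def boxAverage {Ω : Type*} (F : ℝ → ℝ → ℝ) (Y : ℝ≥0 → Ω → ℝ) (k : ℕ) (ω : Ω) : ℝ :=
  ∫ p : I × I, F (Y (k + unitInterval.toNNReal p.1) ω) (Y (k + unitInterval.toNNReal p.2) ω)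

lemma measurable_boxAverage_integrand {Ω : Type*} {mΩ : MeasurableSpace Ω} {F : ℝ → ℝ → ℝ}
    {Y : ℝ≥0 → Ω → ℝ} (hF : Measurable (Function.uncurry F)) (hm : ∀ t, Measurable (Y t))
    (hr : ∀ ω t, ContinuousWithinAt (fun s => Y s ω) (Set.Ici t) t) (k : ℕ) :
    Measurable (fun r : (I × I) × Ω => F (Y (k + unitInterval.toNNReal r.1.1) r.2)
      (Y (k + unitInterval.toNNReal r.1.2) r.2)) := by
  have hY := measurable_uncurry_of_rightContinuous hm hr
  have ht : Measurable unitInterval.toNNReal := unitInterval.toNNReal_continuous.measurable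
  exact hF.comp ((hY.comp (((measurable_const.add (ht.comp (measurable_fst.comp measurable_fst)))
    ).prodMk measurable_snd)).prodMk
    (hY.comp (((measurable_const.add (ht.comp (measurable_snd.comp measurable_fst)))
    ).prodMk measurable_snd)))

lemma measurable_boxAverage {Ω : Type*} {mΩ : MeasurableSpace Ω} {F : ℝ → ℝ → ℝ}
    {Y : ℝ≥0 → Ω → ℝ} (hF : Measurable (Function.uncurry F)) (hm : ∀ t, Measurable (Y t))
    (hr : ∀ ω t, ContinuousWithinAt (fun s => Y s ω) (Set.Ici t) t) (k : ℕ) :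
    Measurable (boxAverage F Y k) :=
  (measurable_boxAverage_integrand hF hm hr k).stronglyMeasurable.integral_prod_left'.measurable

lemma boxAverage_mul_eq_sq {Ω : Type*} (Y : ℝ≥0 → Ω → ℝ) (k : ℕ) (ω : Ω) :
    boxAverage (fun a b => a * b) Y k ω = boxAverage (fun a _ => a) Y k ω ^ 2 := by
  unfold boxAverage
  rw [show (volume : Measure (I × I)) = (volume : Measure I).prod volume from rfl,
    integral_prod_mul (fun x : I => Y (k + unitInterval.toNNReal x) ω)
      (fun x : I => Y (k + unitInterval.toNNReal x) ω),
    integral_fun_fst (fun x : I => Y (k + unitInterval.toNNReal x) ω)]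
  simp [sq]

lemma boxAverage_fst_eq {Ω : Type*} (Y : ℝ≥0 → Ω → ℝ) (k : ℕ) (ω : Ω) :
    boxAverage (fun a _ => a) Y k ω = ∫ s in (k : ℝ)..(k + 1), Y s.toNNReal ω := by
  unfold boxAverage
  rw [show (volume : Measure (I × I)) = (volume : Measure I).prod volume from rfl,
    integral_fun_fst (fun x : I => Y (k + unitInterval.toNNReal x) ω)]
  have h1 : ∀ x : I, (k : ℝ≥0) + unitInterval.toNNReal x = ((x : ℝ) + k).toNNReal := by
    intro x
    ext
    rw [Real.coe_toNNReal _ (by have := x.2.1; positivity)]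
    simp [add_comm]
  simp_rw [h1]
  rw [integral_unitInterval (fun x => Y (x + k).toNNReal ω),
    intervalIntegral.integral_comp_add_right (fun s => Y s.toNNReal ω)]
  simp [add_comm]

lemma abs_boxAverage_le {Ω : Type*} {F : ℝ → ℝ → ℝ} {Y : ℝ≥0 → Ω → ℝ} {y : Fin 2 → ℝ} {D : ℝ}
    (hts : ∀ t ω, ∃ i, Y t ω = y i) (hF : ∀ i j, |F (y i) (y j)| ≤ D) (k : ℕ) (ω : Ω) :
    |boxAverage F Y k ω| ≤ D := by
  have := norm_integral_le_of_norm_le_const (μ := (volume : Measure (I × I))) (C := D)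
    (f := fun p => F (Y (k + unitInterval.toNNReal p.1) ω) (Y (k + unitInterval.toNNReal p.2) ω))
    (Filter.Eventually.of_forall fun p => by
      obtain ⟨i, hi⟩ := hts (k + unitInterval.toNNReal p.1) ω
      obtain ⟨j, hj⟩ := hts (k + unitInterval.toNNReal p.2) ω
      rw [hi, hj]
      exact hF i j)
  simpa [boxAverage] using this

section Telegraph

variable {Ω : Type*} [MeasurableSpace Ω] {P : Measure Ω} [IsProbabilityMeasure P] {y : Fin 2 → ℝ}
  {lam mu : ℝ} {Y : ℝ≥0 → Ω → ℝ}

lemma IsTelegraph.integral_boxAverage (hY : IsTelegraph P y lam mu Y)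
    {F : ℝ → ℝ → ℝ} (hF : Measurable (Function.uncurry F)) (k : ℕ) :
    ∫ ω, boxAverage F Y k ω ∂P = ∫ p : I × I, ∫ ω, F (Y (k + unitInterval.toNNReal p.1) ω)
      (Y (k + unitInterval.toNNReal p.2) ω) ∂P := by
  refine integral_integral_swap (f := fun ω (p : I × I) =>
    F (Y (k + unitInterval.toNNReal p.1) ω) (Y (k + unitInterval.toNNReal p.2) ω)) ?_
  refine Integrable.of_bound (((measurable_boxAverage_integrand hF hY.measurable
    hY.right_continuous k).comp measurable_swap).aestronglyMeasurable)
    (∑ i, ∑ j, |F (y i) (y j)|) (Filter.Eventually.of_forall fun r => ?_)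
  obtain ⟨i, hi⟩ := hY.two_state (k + unitInterval.toNNReal r.2.1) r.1
  obtain ⟨j, hj⟩ := hY.two_state (k + unitInterval.toNNReal r.2.2) r.1
  simp only [Function.uncurry, Real.norm_eq_abs, hi, hj]
  refine (Finset.single_le_sum (f := fun j => |F (y i) (y j)|) (fun _ _ => abs_nonneg _)
    (Finset.mem_univ j)).trans ?_
  exact Finset.single_le_sum (f := fun i => ∑ j, |F (y i) (y j)|)
    (fun _ _ => Finset.sum_nonneg fun _ _ => abs_nonneg _) (Finset.mem_univ i)

lemma IsTelegraph.integral_increment (hY : IsTelegraph P y lam mu Y)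
    (hy : Function.Injective y) (hl : 0 < lam) (hm : 0 < mu) (k : ℕ) :
    ∫ ω, boxAverage (fun a _ => a) Y k ω ∂P = statMean y lam mu := by
  rw [hY.integral_boxAverage (F := fun a _ => a) measurable_fst]
  simp_rw [hY.integral_one hy hl hm]
  simp

lemma IsTelegraph.integral_increment_sq (hY : IsTelegraph P y lam mu Y)
    (hy : Function.Injective y) (hl : 0 < lam) (hm : 0 < mu) (k : ℕ) :
    ∫ ω, boxAverage (fun a b => a * b) Y k ω ∂P = incrMoment y lam mu := by
  rw [hY.integral_boxAverage (F := fun a b => a * b) (measurable_fst.mul measurable_snd)]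
  simp_rw [hY.integral_mul hy hl hm]
  have hint : Integrable (fun p : I × I => Real.exp (-(lam + mu) * |(p.1 : ℝ) - p.2|)) :=
    (by fun_prop : Continuous fun p : I × I =>
      Real.exp (-(lam + mu) * |(p.1 : ℝ) - p.2|)).integrable_of_hasCompactSupport
        (HasCompactSupport.of_compactSpace _)
  simp only [NNReal.coe_add, NNReal.coe_natCast, unitInterval.coe_toNNReal,
    add_sub_add_left_eq_sub]
  rw [integral_add (integrable_const _) (hint.const_mul _), integral_const_mul,
    integral_square_exp (add_pos hl hm).ne']
  simp [incrMoment]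
  ring

end Telegraph

/-- A sum of `T` square-integrable variables whose covariances decay geometrically has second
moment `O(T)`. -/
lemma integral_sq_sum_le {Ω : Type*} [MeasurableSpace Ω] {P : Measure Ω} {Z : ℕ → Ω → ℝ}
    (hZ : ∀ i, MemLp (Z i) 2 P) {D r : ℝ} (hD : 0 ≤ D) (hr0 : 0 ≤ r) (hr1 : r < 1)
    (hcov : ∀ i j, i ≤ j → ∫ ω, Z i ω * Z j ω ∂P ≤ D * r ^ (j - i)) (T : ℕ) :
    ∫ ω, (∑ i ∈ Finset.range T, Z i ω) ^ 2 ∂P ≤ 2 * D / (1 - r) * T := by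
  induction T with
  | zero => simp
  | succ T ih =>
    have hS : MemLp (fun ω => ∑ i ∈ Finset.range T, Z i ω) 2 P :=
      memLp_finsetSum _ fun i _ => hZ i
    have hexp : ∀ ω, (∑ i ∈ Finset.range (T + 1), Z i ω) ^ 2 =
        (∑ i ∈ Finset.range T, Z i ω) ^ 2 + (2 * ∑ i ∈ Finset.range T, Z i ω * Z T ω
          + Z T ω * Z T ω) := by
      intro ω
      rw [Finset.sum_range_succ, ← Finset.sum_mul]
      ring
    have hmul : ∀ i j, Integrable (fun ω => Z i ω * Z j ω) P := fun i j =>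
      (hZ i).integrable_mul (hZ j)
    have hsum : Integrable (fun ω => 2 * ∑ i ∈ Finset.range T, Z i ω * Z T ω) P :=
      (integrable_finsetSum _ fun i _ => hmul i T).const_mul 2
    have hsum' : Integrable
        (fun ω => 2 * ∑ i ∈ Finset.range T, Z i ω * Z T ω + Z T ω * Z T ω) P :=
      hsum.add (hmul T T)
    simp_rw [hexp]
    rw [integral_add hS.integrable_sq hsum', integral_add hsum (hmul T T), integral_const_mul,
      integral_finsetSum _ fun i _ => hmul i T]
    have hgeom : ∑ i ∈ Finset.range (T + 1), r ^ (T - i) ≤ 1 / (1 - r) := by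
      have h := Finset.sum_range_reflect (fun i => r ^ i) (T + 1)
      simp only [Nat.add_sub_cancel] at h
      rw [h, one_div, ← tsum_geometric_of_lt_one hr0 hr1]
      exact (summable_geometric_of_lt_one hr0 hr1).sum_le_tsum _ fun i _ => by positivity
    rw [Finset.sum_range_succ, Nat.sub_self, pow_zero] at hgeom
    have h1 : ∑ i ∈ Finset.range T, ∫ ω, Z i ω * Z T ω ∂P ≤
        D * ∑ i ∈ Finset.range T, r ^ (T - i) := by
      rw [Finset.mul_sum]
      exact Finset.sum_le_sum fun i hi => hcov i T (Finset.mem_range.1 hi).le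
    have h2 := hcov T T le_rfl
    rw [Nat.sub_self, pow_zero, mul_one] at h2
    have h3 := mul_le_mul_of_nonneg_left hgeom hD
    have h4 : 2 * D / (1 - r) * ((T + 1 : ℕ) : ℝ) =
      2 * D / (1 - r) * T + 2 * (D * (1 / (1 - r))) := by push_cast; ring
    rw [h4]
    linarith

/-- The fluctuations of the box averages of the telegraph process are of order `√T`, uniformly
over rates that are at least `c₀`. -/
lemma IsTelegraph.integral_sq_sum_boxAverage_le {Ω : Type*} [MeasurableSpace Ω] {P : Measure Ω}
    [IsProbabilityMeasure P] {y : Fin 2 → ℝ} {lam mu : ℝ} {Y : ℝ≥0 → Ω → ℝ}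
    (hY : IsTelegraph P y lam mu Y) (hy : Function.Injective y) {c₀ : ℝ} (hc₀ : 0 < c₀)
    (hl : c₀ ≤ lam) (hm : c₀ ≤ mu) {F : ℝ → ℝ → ℝ} (hF : Measurable (Function.uncurry F))
    {D e : ℝ} (hFD : ∀ i j, |F (y i) (y j)| ≤ D) (he : ∀ k, ∫ ω, boxAverage F Y k ω ∂P = e)
    (T : ℕ) :
    ∫ ω, (∑ i ∈ Finset.range T, (boxAverage F Y i ω - e)) ^ 2 ∂P ≤
      2 * (16 * D ^ 2 * Real.exp (2 * c₀)) / (1 - Real.exp (-(2 * c₀))) * T := by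
  have hl' : 0 < lam := hc₀.trans_le hl
  have hm' : 0 < mu := hc₀.trans_le hm
  have hmeas : ∀ k, Measurable (boxAverage F Y k) :=
    measurable_boxAverage hF hY.measurable hY.right_continuous
  have hbd : ∀ k ω, |boxAverage F Y k ω| ≤ D := abs_boxAverage_le hY.two_state hFD
  have hL2 : ∀ k, MemLp (boxAverage F Y k) 2 P := fun k =>
    MemLp.of_bound (hmeas k).aestronglyMeasurable D (Filter.Eventually.of_forall (hbd k))
  have hD : 0 ≤ D := (abs_nonneg _).trans (hFD 0 0)
  have heD : |e| ≤ D := by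
    rw [← he 0]
    have := norm_integral_le_of_norm_le_const (μ := P) (f := boxAverage F Y 0)
      (Filter.Eventually.of_forall (hbd 0))
    simpa using this
  refine integral_sq_sum_le (fun k => (hL2 k).sub (memLp_const e)) (by positivity)
    (Real.exp_pos _).le (Real.exp_lt_one_iff.2 (by linarith)) ?_ T
  intro i j hij
  rcases hij.eq_or_lt with rfl | hij
  · rw [Nat.sub_self, pow_zero, mul_one]
    have h1 : ∀ ω, (boxAverage F Y i ω - e) * (boxAverage F Y i ω - e) ≤ 16 * D ^ 2 := by
      intro ω
      have h2 : |boxAverage F Y i ω - e| ≤ 2 * D := (abs_sub _ _).trans (by linarith [hbd i ω])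
      have h3 := pow_le_pow_left₀ (abs_nonneg _) h2 2
      rw [sq_abs] at h3
      nlinarith
    have hint : Integrable (fun ω => (boxAverage F Y i ω - e) * (boxAverage F Y i ω - e)) P :=
      ((hL2 i).sub (memLp_const e)).integrable_mul ((hL2 i).sub (memLp_const e))
    have h4 : ∫ ω, (boxAverage F Y i ω - e) * (boxAverage F Y i ω - e) ∂P ≤ 16 * D ^ 2 := by
      have := integral_mono hint (integrable_const (μ := P) (16 * D ^ 2)) h1
      simpa using this
    refine h4.trans (le_mul_of_one_le_right (by positivity) (Real.one_le_exp (by linarith)))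
  -- the squares with corners `i` and `j` are separated by the gap `j - i - 1`; the factor
  -- `exp (2 c₀)` in the constant makes up for the `1`
  · have hd : (0 : ℝ) ≤ (j : ℝ) - i - 1 := by
      have : ((i + 1 : ℕ) : ℝ) ≤ j := Nat.cast_le.2 hij
      push_cast at this
      linarith
    have hcov := abs_cov_integral_le (P := P) (ν := (volume : Measure (I × I)))
      (measurable_boxAverage_integrand hF hY.measurable hY.right_continuous i)
      (measurable_boxAverage_integrand hF hY.measurable hY.right_continuous j) (D := D)
      (c := 16 * (D ^ 2 * Real.exp (-(lam + mu) * ((j : ℝ) - i - 1))))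
      (H := fun p ω => F (Y (i + unitInterval.toNNReal p.1) ω)
        (Y (i + unitInterval.toNNReal p.2) ω))
      (G := fun p ω => F (Y (j + unitInterval.toNNReal p.1) ω)
        (Y (j + unitInterval.toNNReal p.2) ω))
      (fun p ω => by
        obtain ⟨a, ha⟩ := hY.two_state (i + unitInterval.toNNReal p.1) ω
        obtain ⟨b, hb⟩ := hY.two_state (i + unitInterval.toNNReal p.2) ω
        rw [ha, hb]
        exact hFD a b)
      (fun p ω => by
        obtain ⟨a, ha⟩ := hY.two_state (j + unitInterval.toNNReal p.1) ω
        obtain ⟨b, hb⟩ := hY.two_state (j + unitInterval.toNNReal p.2) ω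
        rw [ha, hb]
        exact hFD a b)
      (fun p q => by
        have h1 := p.1.2.2
        have h2 := p.2.2.2
        have h3 := q.1.2.1
        have h4 := q.2.2.1
        refine hY.abs_cov_le hy hl' hm' hFD hFD ?_ ?_ ?_ ?_ hd <;>
          simp only [NNReal.coe_add, NNReal.coe_natCast, unitInterval.coe_toNNReal] <;> linarith)
    have hexp : ∫ ω, (boxAverage F Y i ω - e) * (boxAverage F Y j ω - e) ∂P =
        ∫ ω, boxAverage F Y i ω * boxAverage F Y j ω ∂P -
          (∫ ω, boxAverage F Y i ω ∂P) * ∫ ω, boxAverage F Y j ω ∂P := by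
      simpa only [covariance, he, Pi.mul_apply] using covariance_eq_sub (hL2 i) (hL2 j)
    refine hexp.le.trans ?_
    refine (le_abs_self _).trans (hcov.trans ?_)
    rw [← Real.exp_nat_mul, mul_assoc (16 * D ^ 2), ← Real.exp_add, ← mul_assoc]
    refine mul_le_mul_of_nonneg_left (Real.exp_le_exp.2 ?_) (by positivity)
    rw [Nat.cast_sub hij.le]
    nlinarith

/-! ### The Wiener increments -/

section Wiener

variable {Ω : Type*} [MeasurableSpace Ω] {P : Measure Ω} {W : ℝ≥0 → Ω → ℝ}

lemma integral_sq_gaussianReal (v : ℝ≥0) : ∫ x, x ^ 2 ∂gaussianReal 0 v = v := by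
  rw [← variance_fun_id_gaussianReal (μ := 0) (v := v),
    variance_of_integral_eq_zero aemeasurable_id' integral_id_gaussianReal]

lemma hasLaw_wienerIncrement (hW : IsBrownianReal W P) (k : ℕ) :
    HasLaw (fun ω => W ((k : ℝ≥0) + 1) ω - W k ω) (gaussianReal 0 1) P := by
  have h := hW.toIsPreBrownianReal.hasLaw_sub ((k : ℝ≥0) + 1) k
  have h1 : nndist (((k : ℝ≥0) + 1 : ℝ≥0) : ℝ) ((k : ℝ≥0) : ℝ) = 1 := by
    ext
    simp
  change HasLaw _ (gaussianReal 0 (nndist (((k : ℝ≥0) + 1 : ℝ≥0) : ℝ) ((k : ℝ≥0) : ℝ))) P at h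
  rw [h1] at h
  exact h

lemma iIndepFun_wienerIncrement (hW : IsBrownianReal W P) :
    iIndepFun (fun (k : ℕ) ω => W ((k : ℝ≥0) + 1) ω - W k ω) P := by
  have h := hW.toIsPreBrownianReal.hasIndepIncrements.nat (t := fun n : ℕ => (n : ℝ≥0))
    Nat.mono_cast
  simpa using h

lemma memLp_wienerIncrement (hW : IsBrownianReal W P) (k : ℕ) {p : ℝ≥0∞} (hp : p ≠ ∞) :
    MemLp (fun ω => W ((k : ℝ≥0) + 1) ω - W k ω) p P := by
  have h := hasLaw_wienerIncrement hW k
  have h2 := memLp_id_gaussianReal' (μ := 0) (v := 1) p hp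
  rw [← h.map_eq] at h2
  exact (memLp_map_measure_iff aestronglyMeasurable_id h.aemeasurable).1 h2

lemma integral_wienerIncrement_mul [IsProbabilityMeasure P] (hW : IsBrownianReal W P) (i j : ℕ) :
    ∫ ω, (W ((i : ℝ≥0) + 1) ω - W i ω) * (W ((j : ℝ≥0) + 1) ω - W j ω) ∂P =
      if i = j then 1 else 0 := by
  split_ifs with h
  · subst h
    have h1 := (hasLaw_wienerIncrement hW i).integral_comp (f := fun x : ℝ => x ^ 2)
      (by fun_prop)
    rw [integral_sq_gaussianReal] at h1
    simpa [Function.comp_def, sq] using h1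
  · rw [((iIndepFun_wienerIncrement hW).indepFun h).integral_fun_mul_eq_mul_integral
      (memLp_wienerIncrement hW i ENNReal.one_ne_top).aestronglyMeasurable
      (memLp_wienerIncrement hW j ENNReal.one_ne_top).aestronglyMeasurable,
      (hasLaw_wienerIncrement hW i).integral_eq]
    simp

lemma memLp_wiener_sq_sub_one [IsProbabilityMeasure P] (hW : IsBrownianReal W P) (i : ℕ) :
    MemLp (fun ω => (W ((i : ℝ≥0) + 1) ω - W i ω) ^ 2 - 1) 2 P := by
  have h4 := memLp_wienerIncrement hW i (p := 4) (by norm_num)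
  have h2 : MemLp (fun ω => (W ((i : ℝ≥0) + 1) ω - W i ω) ^ 2) 2 P := by
    refine (memLp_two_iff_integrable_sq (h4.aestronglyMeasurable.pow 2)).2 ?_
    have := h4.integrable_norm_pow (p := 4) (by norm_num)
    refine this.congr (Filter.Eventually.of_forall fun ω => ?_)
    simp only [Real.norm_eq_abs, Pi.pow_apply]
    rw [← pow_mul, show 2 * 2 = 4 from rfl, Even.pow_abs (by decide)]
  exact h2.sub (memLp_const 1)

/-- The fluctuations of the quadratic variation of the noise are of order `√T`. -/
lemma integral_sq_sum_wiener_sq_le [IsProbabilityMeasure P] (hW : IsBrownianReal W P) (T : ℕ) :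
    ∫ ω, (∑ i ∈ Finset.range T, ((W ((i : ℝ≥0) + 1) ω - W i ω) ^ 2 - 1)) ^ 2 ∂P ≤
      2 * (∫ x : ℝ, (x ^ 2 - 1) ^ 2 ∂gaussianReal 0 1) * (T : ℝ) := by
  have hmem := memLp_wiener_sq_sub_one hW
  -- rate `0`: different increments are uncorrelated, and `0 ^ (j - i)` is `1` on the diagonal
  have h := integral_sq_sum_le hmem (D := ∫ x, (x ^ 2 - 1) ^ 2 ∂gaussianReal 0 1) (r := 0)
    (integral_nonneg fun x => sq_nonneg _) le_rfl one_pos ?_ T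
  · simpa using h
  intro i j hij
  rcases hij.eq_or_lt with rfl | hlt
  · have h1 := (hasLaw_wienerIncrement hW i).integral_comp (f := fun x : ℝ => (x ^ 2 - 1) ^ 2)
      (by fun_prop)
    rw [← h1]
    simp [sq]
  · have hind : IndepFun (fun ω => (W ((i : ℝ≥0) + 1) ω - W i ω) ^ 2 - 1)
        (fun ω => (W ((j : ℝ≥0) + 1) ω - W j ω) ^ 2 - 1) P :=
      ((iIndepFun_wienerIncrement hW).indepFun hlt.ne).comp
        (φ := fun x : ℝ => x ^ 2 - 1) (ψ := fun x : ℝ => x ^ 2 - 1) (by fun_prop) (by fun_prop)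
    have h0 : ∫ ω, ((W ((i : ℝ≥0) + 1) ω - W i ω) ^ 2 - 1) ∂P = 0 := by
      have h1 := (hasLaw_wienerIncrement hW i).integral_comp (f := fun x : ℝ => x ^ 2 - 1)
        (by fun_prop)
      have h2 : Integrable (fun x : ℝ => x ^ 2) (gaussianReal 0 1) :=
        (memLp_id_gaussianReal' (μ := 0) (v := 1) 2 (by norm_num)).integrable_sq
      rw [integral_sub h2 (integrable_const _), integral_sq_gaussianReal] at h1
      simpa [Function.comp_def] using h1
    rw [hind.integral_fun_mul_eq_mul_integral (hmem i).aestronglyMeasurable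
      (hmem j).aestronglyMeasurable, h0, zero_mul, zero_pow (by omega), mul_zero]

/-- The cross terms of signal and noise are orthogonal, by independence. -/
lemma integral_sq_sum_cross_le [IsProbabilityMeasure P] (hW : IsBrownianReal W P)
    (hWm : ∀ t, Measurable (W t)) {y : Fin 2 → ℝ} {lam mu : ℝ} {Y : ℝ≥0 → Ω → ℝ}
    (hY : IsTelegraph P y lam mu Y)
    (hind : IndepFun (fun ω (t : ℝ≥0) => Y t ω) (fun ω (t : ℝ≥0) => W t ω) P)
    {A : ℝ} (hA : ∀ i, |y i| ≤ A) (T : ℕ) :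
    MemLp (fun ω => ∑ i ∈ Finset.range T,
        boxAverage (fun a _ => a) Y i ω * (W ((i : ℝ≥0) + 1) ω - W i ω)) 2 P ∧
    ∫ ω, (∑ i ∈ Finset.range T,
        boxAverage (fun a _ => a) Y i ω * (W ((i : ℝ≥0) + 1) ω - W i ω)) ^ 2 ∂P ≤
      2 * A ^ 2 * T := by
  have hmeas : ∀ k, Measurable (boxAverage (fun a _ => a) Y k) :=
    measurable_boxAverage (F := fun a _ => a) measurable_fst hY.measurable hY.right_continuous
  have hbd : ∀ k ω, |boxAverage (fun a _ => a) Y k ω| ≤ A :=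
    abs_boxAverage_le hY.two_state fun i _ => hA i
  have hmem : ∀ i : ℕ, MemLp (fun ω =>
      boxAverage (fun a _ => a) Y i ω * (W ((i : ℝ≥0) + 1) ω - W i ω)) 2 P := by
    intro i
    refine (memLp_wienerIncrement hW i (p := 2) (by norm_num)).of_le_mul (c := A)
      ((hmeas i).mul ((hWm _).sub (hWm _))).aestronglyMeasurable
      (Filter.Eventually.of_forall fun ω => ?_)
    rw [norm_mul]
    exact mul_le_mul_of_nonneg_right (hbd i ω) (norm_nonneg _)
  refine ⟨memLp_finsetSum _ fun i _ => hmem i, ?_⟩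
  have h := integral_sq_sum_le hmem (D := A ^ 2) (r := 0) (by positivity) le_rfl one_pos ?_ T
  · simpa using h
  intro i j hij
  have hindij : IndepFun
      (fun ω => boxAverage (fun a _ => a) Y i ω * boxAverage (fun a _ => a) Y j ω)
      (fun ω => (W ((i : ℝ≥0) + 1) ω - W i ω) * (W ((j : ℝ≥0) + 1) ω - W j ω)) P := by
    rw [IndepFun_iff_Indep] at hind ⊢
    refine indep_of_indep_of_le_left (indep_of_indep_of_le_right hind ?_) ?_
    · have hφ : Measurable (fun w : ℝ≥0 → ℝ =>
          (w ((i : ℝ≥0) + 1) - w i) * (w ((j : ℝ≥0) + 1) - w j)) := by fun_prop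
      exact (hφ.comp (comap_measurable (fun ω (t : ℝ≥0) => W t ω))).comap_le
    -- the integrals are measurable for the `σ`-algebra generated by `Y`, by right-continuity
    · have hb : ∀ k, Measurable[MeasurableSpace.comap (fun ω (t : ℝ≥0) => Y t ω) inferInstance]
          (boxAverage (fun a _ => a) Y k) := fun k =>
        measurable_boxAverage (F := fun a _ => a) measurable_fst
          (fun t => (measurable_pi_apply t).comp (comap_measurable _)) hY.right_continuous k
      exact ((hb i).mul (hb j)).comap_le
  have hre : ∀ ω, boxAverage (fun a _ => a) Y i ω * (W ((i : ℝ≥0) + 1) ω - W i ω) *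
      (boxAverage (fun a _ => a) Y j ω * (W ((j : ℝ≥0) + 1) ω - W j ω)) =
      (boxAverage (fun a _ => a) Y i ω * boxAverage (fun a _ => a) Y j ω) *
      ((W ((i : ℝ≥0) + 1) ω - W i ω) * (W ((j : ℝ≥0) + 1) ω - W j ω)) := fun ω => by ring
  simp_rw [hre]
  rw [hindij.integral_fun_mul_eq_mul_integral
    ((hmeas i).mul (hmeas j)).aestronglyMeasurable
    (((hWm _).sub (hWm _)).mul ((hWm _).sub (hWm _))).aestronglyMeasurable,
    integral_wienerIncrement_mul hW]
  rcases hij.eq_or_lt with rfl | hlt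
  · rw [if_pos rfl, mul_one, Nat.sub_self, pow_zero, mul_one]
    have := norm_integral_le_of_norm_le_const (μ := P) (C := A ^ 2)
      (f := fun ω => boxAverage (fun a _ => a) Y i ω * boxAverage (fun a _ => a) Y i ω)
      (Filter.Eventually.of_forall fun ω => by
        rw [Real.norm_eq_abs, abs_mul, sq]
        exact mul_le_mul (hbd i ω) (hbd i ω) (abs_nonneg _) ((abs_nonneg _).trans (hbd i ω)))
    exact (le_abs_self _).trans (by simpa using this)
  · rw [if_neg hlt.ne, mul_zero, zero_pow (by omega), mul_zero]

end Wiener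

/-! ### The empirical moments of the observed path -/

section Observation

variable {Ω : Type*} [MeasurableSpace Ω] {P : Measure Ω} {y : Fin 2 → ℝ} {lam mu : ℝ}
  {Y W : ℝ≥0 → Ω → ℝ}

lemma IsTelegraph.intervalIntegrable (hY : IsTelegraph P y lam mu Y) (ω : Ω) (a b : ℝ) :
    IntervalIntegrable (fun s : ℝ => Y s.toNNReal ω) volume a b := by
  have hm : Measurable (fun s : ℝ => Y s.toNNReal ω) :=
    (measurable_uncurry_of_rightContinuous hY.measurable hY.right_continuous).comp
      (measurable_real_toNNReal.prodMk measurable_const)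
  refine (intervalIntegrable_const (c := max |y 0| |y 1|)).mono_fun hm.aestronglyMeasurable
    (Filter.Eventually.of_forall fun s => ?_)
  obtain ⟨i, hi⟩ := hY.two_state s.toNNReal ω
  simp only [hi, Real.norm_eq_abs]
  refine le_trans ?_ (le_abs_self _)
  fin_cases i
  · exact le_max_left _ _
  · exact le_max_right _ _

lemma IsTelegraph.mean_observation_sub (hY : IsTelegraph P y lam mu Y) (X₀ : Ω → ℝ) (ω : Ω)
    {T : ℕ} (hT : 0 < T) (e : ℝ) :
    mean (observation X₀ Y W ω) T - e =
      (X₀ ω + ∑ i ∈ Finset.range T, (boxAverage (fun a _ => a) Y i ω - e) + W T ω) / T := by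
  have hT' : (T : ℝ) ≠ 0 := by positivity
  have h := intervalIntegral.sum_integral_adjacent_intervals (f := fun s : ℝ => Y s.toNNReal ω)
    (μ := volume) (a := fun k : ℕ => (k : ℝ)) (n := T)
    fun k _ => hY.intervalIntegrable ω _ _
  simp only [Nat.cast_add, Nat.cast_one, Nat.cast_zero] at h
  simp only [mean, observation, boxAverage_fst_eq, Finset.sum_sub_distrib, NNReal.coe_natCast, h]
  simp
  field_simp
  ring

lemma IsTelegraph.zeta_observation_sub (hY : IsTelegraph P y lam mu Y) (X₀ : Ω → ℝ) (ω : Ω)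
    {T : ℕ} (hT : 0 < T) (e : ℝ) :
    zeta (observation X₀ Y W ω) T - e =
      (∑ i ∈ Finset.range T, (boxAverage (fun a b => a * b) Y i ω - e) +
        2 * ∑ i ∈ Finset.range T,
          boxAverage (fun a _ => a) Y i ω * (W ((i : ℝ≥0) + 1) ω - W i ω) +
        ∑ i ∈ Finset.range T, ((W ((i : ℝ≥0) + 1) ω - W i ω) ^ 2 - 1)) / T := by
  have hT' : (T : ℝ) ≠ 0 := by positivity
  have hinc : ∀ i : ℕ, observation X₀ Y W ω ((i : ℝ≥0) + 1) - observation X₀ Y W ω i =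
      boxAverage (fun a _ => a) Y i ω + (W ((i : ℝ≥0) + 1) ω - W i ω) := by
    intro i
    have h := intervalIntegral.integral_interval_sub_left (hY.intervalIntegrable ω 0 ((i : ℝ) + 1))
      (hY.intervalIntegrable ω 0 i)
    rw [boxAverage_fst_eq, ← h]
    simp only [observation, NNReal.coe_add, NNReal.coe_natCast, NNReal.coe_one]
    ring
  simp only [zeta, hinc, boxAverage_mul_eq_sq, add_sq, Finset.sum_sub_distrib,
    Finset.sum_add_distrib, mul_assoc, ← Finset.mul_sum]
  simp
  field_simp
  ring

end Observation

lemma add_add_sq_le (a b c : ℝ) : (a + b + c) ^ 2 ≤ 3 * (a ^ 2 + b ^ 2 + c ^ 2) := by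
  nlinarith [sq_nonneg (a - b), sq_nonneg (b - c), sq_nonneg (a - c)]

/-- Both empirical moments have mean square error `O(1 / T)`, uniformly over rates at least `c₀`
and initial values of second moment at most `M`, and so has every estimator whose error they
dominate. No measurability of the estimator is needed. -/
lemma lintegral_sq_error_le {y : Fin 2 → ℝ} (hy : Function.Injective y) {c₀ : ℝ} (hc₀ : 0 < c₀)
    (M : ℝ) :
    ∃ V₁ V₂ : ℝ, ∀ (lam mu : ℝ), c₀ ≤ lam → c₀ ≤ mu →
      ∀ (Ω : Type*) [MeasurableSpace Ω] (P : Measure Ω) [IsProbabilityMeasure P]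
        (X₀ : Ω → ℝ) (Y W : ℝ≥0 → Ω → ℝ), IsModel P y lam mu X₀ Y W →
        ∫ ω, X₀ ω ^ 2 ∂P ≤ M →
      ∀ T : ℕ, 0 < T → ∀ (k₁ k₂ : ℝ), 0 ≤ k₁ → 0 ≤ k₂ → ∀ err : Ω → ℝ,
        (∀ ω, err ω ^ 2 ≤ k₁ * (mean (observation X₀ Y W ω) T - statMean y lam mu) ^ 2 +
          k₂ * (zeta (observation X₀ Y W ω) T - incrMoment y lam mu) ^ 2) →
        ∫⁻ ω, ENNReal.ofReal ((√(T : ℝ) * err ω) ^ 2) ∂P ≤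
          ENNReal.ofReal (k₁ * V₁ + k₂ * V₂) := by
  set A : ℝ := |y 0| + |y 1| with hAdef
  have hA : ∀ i, |y i| ≤ A := by
    intro i
    fin_cases i
    · exact le_add_of_nonneg_right (abs_nonneg _)
    · exact le_add_of_nonneg_left (abs_nonneg _)
  have hAA : ∀ i j, |y i * y j| ≤ A ^ 2 := fun i j => by
    rw [abs_mul, sq]
    exact mul_le_mul (hA i) (hA j) (abs_nonneg _) ((abs_nonneg _).trans (hA i))
  set κ : ℝ → ℝ := fun D => 2 * (16 * D ^ 2 * Real.exp (2 * c₀)) / (1 - Real.exp (-(2 * c₀)))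
    with hκ
  set g : ℝ := ∫ x, (x ^ 2 - 1) ^ 2 ∂gaussianReal 0 1 with hg
  refine ⟨3 * (M + κ A + 1), 3 * (κ (A ^ 2) + 4 * (2 * A ^ 2) + 2 * g), ?_⟩
  intro lam mu hl hm Ω _ P _ X₀ Y W hmod hM T hT k₁ k₂ hk₁ hk₂ err herr
  have hl' : 0 < lam := hc₀.trans_le hl
  have hm' : 0 < mu := hc₀.trans_le hm
  have hY := hmod.telegraph
  have hW := hmod.wiener
  have hT0 : (0 : ℝ) < T := by positivity
  have hT1 : (1 : ℝ) ≤ T := by exact_mod_cast hT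
  have hM0 : 0 ≤ M := (integral_nonneg fun ω => sq_nonneg _).trans hM
  set S₁ : Ω → ℝ := fun ω =>
    ∑ i ∈ Finset.range T, (boxAverage (fun a _ => a) Y i ω - statMean y lam mu) with hS₁
  set S₂ : Ω → ℝ := fun ω =>
    ∑ i ∈ Finset.range T, (boxAverage (fun a b => a * b) Y i ω - incrMoment y lam mu) with hS₂
  set S₃ : Ω → ℝ := fun ω => ∑ i ∈ Finset.range T,
    boxAverage (fun a _ => a) Y i ω * (W ((i : ℝ≥0) + 1) ω - W i ω) with hS₃
  set S₄ : Ω → ℝ := fun ω =>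
    ∑ i ∈ Finset.range T, ((W ((i : ℝ≥0) + 1) ω - W i ω) ^ 2 - 1) with hS₄
  have hmulm : Measurable (Function.uncurry fun a b : ℝ => a * b) :=
    measurable_fst.mul measurable_snd
  have hfstm : Measurable (Function.uncurry fun a _ : ℝ => a) := measurable_fst
  have iS₁ : Integrable (fun ω => S₁ ω ^ 2) P := by
    refine MemLp.integrable_sq (memLp_finsetSum _ fun i _ => MemLp.sub ?_ (memLp_const _))
    exact MemLp.of_bound (measurable_boxAverage hfstm hY.measurable
      hY.right_continuous i).aestronglyMeasurable A
      (Filter.Eventually.of_forall (abs_boxAverage_le hY.two_state (fun i _ => hA i) i))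
  have iS₂ : Integrable (fun ω => S₂ ω ^ 2) P := by
    refine MemLp.integrable_sq (memLp_finsetSum _ fun i _ => MemLp.sub ?_ (memLp_const _))
    exact MemLp.of_bound (measurable_boxAverage hmulm hY.measurable
      hY.right_continuous i).aestronglyMeasurable (A ^ 2)
      (Filter.Eventually.of_forall (abs_boxAverage_le hY.two_state hAA i))
  have h₃ := integral_sq_sum_cross_le hW hmod.measurable_noise hY hmod.indep hA T
  have iS₃ : Integrable (fun ω => S₃ ω ^ 2) P := h₃.1.integrable_sq
  have iS₄ : Integrable (fun ω => S₄ ω ^ 2) P :=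
    MemLp.integrable_sq (memLp_finsetSum _ fun i _ => memLp_wiener_sq_sub_one hW i)
  have iX : Integrable (fun ω => X₀ ω ^ 2) P := hmod.initial_memLp.integrable_sq
  have hWlaw := hW.toIsPreBrownianReal.hasLaw_eval T
  have iW : Integrable (fun ω => W T ω ^ 2) P :=
    hWlaw.hasGaussianLaw.memLp_two.integrable_sq
  have e₁ : ∫ ω, S₁ ω ^ 2 ∂P ≤ κ A * T :=
    hY.integral_sq_sum_boxAverage_le hy hc₀ hl hm hfstm (fun i _ => hA i)
      (hY.integral_increment hy hl' hm') T
  have e₂ : ∫ ω, S₂ ω ^ 2 ∂P ≤ κ (A ^ 2) * T :=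
    hY.integral_sq_sum_boxAverage_le hy hc₀ hl hm hmulm hAA
      (hY.integral_increment_sq hy hl' hm') T
  have e₃ : ∫ ω, S₃ ω ^ 2 ∂P ≤ 2 * A ^ 2 * T := h₃.2
  have e₄ : ∫ ω, S₄ ω ^ 2 ∂P ≤ 2 * g * T := integral_sq_sum_wiener_sq_le hW T
  have eW : ∫ ω, W T ω ^ 2 ∂P = T := by
    have h := hWlaw.integral_comp (f := fun x : ℝ => x ^ 2) (by fun_prop)
    rw [integral_sq_gaussianReal] at h
    simpa [Function.comp_def] using h
  set R : Ω → ℝ := fun ω => 3 * k₁ / T * (X₀ ω ^ 2 + S₁ ω ^ 2 + W T ω ^ 2) +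
    3 * k₂ / T * (S₂ ω ^ 2 + 4 * S₃ ω ^ 2 + S₄ ω ^ 2) with hR
  have iR₁ : Integrable (fun ω => X₀ ω ^ 2 + S₁ ω ^ 2) P := iX.add iS₁
  have iR₂ : Integrable (fun ω => X₀ ω ^ 2 + S₁ ω ^ 2 + W T ω ^ 2) P := iR₁.add iW
  have iR₃ : Integrable (fun ω => S₂ ω ^ 2 + 4 * S₃ ω ^ 2) P := iS₂.add (iS₃.const_mul 4)
  have iR₄ : Integrable (fun ω => S₂ ω ^ 2 + 4 * S₃ ω ^ 2 + S₄ ω ^ 2) P := iR₃.add iS₄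
  have iR : Integrable R P := (iR₂.const_mul _).add (iR₄.const_mul _)
  have hpt : ∀ ω, (√(T : ℝ) * err ω) ^ 2 ≤ R ω := by
    intro ω
    rw [mul_pow, Real.sq_sqrt hT0.le]
    have h1 := herr ω
    rw [hY.mean_observation_sub X₀ ω hT, hY.zeta_observation_sub X₀ ω hT, div_pow, div_pow] at h1
    have h2 := add_add_sq_le (X₀ ω) (S₁ ω) (W T ω)
    have h3 := add_add_sq_le (S₂ ω) (2 * S₃ ω) (S₄ ω)
    calc (T : ℝ) * err ω ^ 2 ≤ T * (k₁ * ((X₀ ω + S₁ ω + W T ω) ^ 2 / T ^ 2) +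
          k₂ * ((S₂ ω + 2 * S₃ ω + S₄ ω) ^ 2 / T ^ 2)) := by gcongr
      _ ≤ T * (k₁ * (3 * (X₀ ω ^ 2 + S₁ ω ^ 2 + W T ω ^ 2) / T ^ 2) +
          k₂ * (3 * (S₂ ω ^ 2 + (2 * S₃ ω) ^ 2 + S₄ ω ^ 2) / T ^ 2)) := by gcongr
      _ = R ω := by rw [hR]; field_simp; ring
  calc ∫⁻ ω, ENNReal.ofReal ((√(T : ℝ) * err ω) ^ 2) ∂P ≤ ∫⁻ ω, ENNReal.ofReal (R ω) ∂P :=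
        lintegral_mono fun ω => ENNReal.ofReal_le_ofReal (hpt ω)
    _ = ENNReal.ofReal (∫ ω, R ω ∂P) :=
        (ofReal_integral_eq_lintegral_ofReal iR
          (Filter.Eventually.of_forall fun ω => (sq_nonneg _).trans (hpt ω))).symm
    _ ≤ _ := ENNReal.ofReal_le_ofReal ?_
  have hint : ∫ ω, R ω ∂P = 3 * k₁ / T * (∫ ω, X₀ ω ^ 2 ∂P + ∫ ω, S₁ ω ^ 2 ∂P + T) +
      3 * k₂ / T * (∫ ω, S₂ ω ^ 2 ∂P + 4 * ∫ ω, S₃ ω ^ 2 ∂P + ∫ ω, S₄ ω ^ 2 ∂P) := by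
    rw [hR, integral_add (iR₂.const_mul _) (iR₄.const_mul _), integral_const_mul,
      integral_const_mul, integral_add iR₁ iW, integral_add iX iS₁, integral_add iR₃ iS₄,
      integral_add iS₂ (iS₃.const_mul 4), integral_const_mul, eW]
  rw [hint]
  calc _ ≤ 3 * k₁ / T * (M * T + κ A * T + T) +
        3 * k₂ / T * (κ (A ^ 2) * T + 4 * (2 * A ^ 2 * T) + 2 * g * T) := by
        gcongr
        exact hM.trans (le_mul_of_one_le_right hM0 hT1)
    _ = _ := by field_simp

end HiddenTelegraph

theorem theorem1 (y₁ y₂ c₀ c₁ M : ℝ) (hy : y₁ ≠ y₂) (hc₀ : 0 < c₀) (hc : c₀ < c₁)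
    (J : Set ℝ) (hJ : J.OrdConnected) (hJpos : J ⊆ Set.Ioi 0) (hJbdd : BddAbove J)
    (K : Set (ℝ × ℝ)) (hK : IsCompact K)
    (hKc : K ⊆ Set.Icc c₀ c₁ ×ˢ Set.Icc c₀ c₁)
    (hKJ : ∀ ϑ ∈ K, ϑ.1 + ϑ.2 ∈ interior J) :
    ∃ C : ℝ, 0 < C ∧
      ∀ lam mu : ℝ, (lam, mu) ∈ K →
      ∀ (Ω : Type*) [MeasurableSpace Ω] (P : Measure Ω) [IsProbabilityMeasure P]
        (X₀ : Ω → ℝ) (Y W : ℝ≥0 → Ω → ℝ),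
        HiddenTelegraph.IsModel P ![y₁, y₂] lam mu X₀ Y W →
        ∫ ω, X₀ ω ^ 2 ∂P ≤ M →
      ∀ T : ℕ, 0 < T →
        (∫⁻ ω, ENNReal.ofReal ((√(T : ℝ) * (HiddenTelegraph.lambdaHat ![y₁, y₂] c₀ c₁ J
            (HiddenTelegraph.observation X₀ Y W ω) T - lam)) ^ 2) ∂P < ENNReal.ofReal C) ∧
        (∫⁻ ω, ENNReal.ofReal ((√(T : ℝ) * (HiddenTelegraph.muHat ![y₁, y₂] c₀ c₁ J
            (HiddenTelegraph.observation X₀ Y W ω) T - mu)) ^ 2) ∂P < ENNReal.ofReal C) := by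
  have hinj : Function.Injective ![y₁, y₂] := by
    intro i j hij
    fin_cases i <;> fin_cases j <;> simp_all
  obtain ⟨C, hC, B, hB⟩ := HiddenTelegraph.beta_error (y := ![y₁, y₂]) (by simpa using hy)
    hc₀ hc hJpos hJbdd hK hKc hKJ
  obtain ⟨V₁, V₂, hV⟩ := HiddenTelegraph.lintegral_sq_error_le hinj hc₀ M
  set k : ℝ := 2 * (B ^ 2 / (y₂ - y₁) ^ 2 + C) with hk
  have hk0 : 0 ≤ k := by positivity
  have hsub : y₂ - y₁ ≠ 0 := sub_ne_zero.2 hy.symm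
  refine ⟨|k * V₁ + 2 * C * V₂| + 1, by positivity, ?_⟩
  intro lam mu hϑ Ω _ P _ X₀ Y W hmod hM T hT
  obtain ⟨⟨hl, -⟩, hm, -⟩ := hKc hϑ
  simp only at hl hm
  have hl' : 0 < lam := hc₀.trans_le hl
  have hm' : 0 < mu := hc₀.trans_le hm
  have hs : 0 < lam + mu := add_pos hl' hm'
  have hlt : ENNReal.ofReal (k * V₁ + 2 * C * V₂) <
      ENNReal.ofReal (|k * V₁ + 2 * C * V₂| + 1) :=
    (ENNReal.ofReal_lt_ofReal_iff (by positivity)).2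
      (by linarith [le_abs_self (k * V₁ + 2 * C * V₂)])
  -- either estimator is a weight in `[0, 1]`, estimated through the mean, times the estimator `β`
  have key : ∀ (x : ℝ≥0 → ℝ) (w σ r : ℝ), |σ| = 1 → 0 ≤ r → r ≤ 1 →
      (w = σ * (HiddenTelegraph.mean x T - HiddenTelegraph.statMean ![y₁, y₂] lam mu) /
          (y₂ - y₁) * HiddenTelegraph.beta ![y₁, y₂] c₀ c₁ J x T +
        r * (HiddenTelegraph.beta ![y₁, y₂] c₀ c₁ J x T - (lam + mu))) →
      w ^ 2 ≤ k * (HiddenTelegraph.mean x T - HiddenTelegraph.statMean ![y₁, y₂] lam mu) ^ 2 +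
        2 * C * (HiddenTelegraph.zeta x T - HiddenTelegraph.incrMoment ![y₁, y₂] lam mu) ^ 2 := by
    intro x w σ r hσ hr0 hr1 hw
    obtain ⟨hb, herr⟩ := hB x T
    have herr := herr lam mu hϑ
    set b := HiddenTelegraph.beta ![y₁, y₂] c₀ c₁ J x T
    set u := HiddenTelegraph.mean x T - HiddenTelegraph.statMean ![y₁, y₂] lam mu
    set v := HiddenTelegraph.zeta x T - HiddenTelegraph.incrMoment ![y₁, y₂] lam mu
    have h1 : w ^ 2 ≤ 2 * ((σ * u / (y₂ - y₁) * b) ^ 2 + (r * (b - (lam + mu))) ^ 2) := by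
      rw [hw]
      nlinarith [sq_nonneg (σ * u / (y₂ - y₁) * b - r * (b - (lam + mu)))]
    have hσ2 : σ ^ 2 = 1 := by rw [← sq_abs, hσ, one_pow]
    have hb2 : b ^ 2 ≤ B ^ 2 := by
      rw [← sq_abs b]
      exact pow_le_pow_left₀ (abs_nonneg _) hb 2
    have h2 : (σ * u / (y₂ - y₁) * b) ^ 2 ≤ B ^ 2 / (y₂ - y₁) ^ 2 * u ^ 2 := by
      rw [mul_pow, div_pow, mul_pow, hσ2, one_mul, div_mul_eq_mul_div, div_mul_eq_mul_div,
        mul_comm (B ^ 2)]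
      gcongr
    have h3 : (r * (b - (lam + mu))) ^ 2 ≤ C * (u ^ 2 + v ^ 2) := by
      rw [mul_pow]
      exact (mul_le_of_le_one_left (sq_nonneg _) (pow_le_one₀ hr0 hr1)).trans herr
    calc w ^ 2 ≤ 2 * (B ^ 2 / (y₂ - y₁) ^ 2 * u ^ 2 + C * (u ^ 2 + v ^ 2)) := by linarith
      _ = k * u ^ 2 + 2 * C * v ^ 2 := by rw [hk]; ring
  constructor
  · refine lt_of_le_of_lt (hV lam mu hl hm Ω P X₀ Y W hmod hM T hT k (2 * C) hk0 (by positivity)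
      _ fun ω => ?_) hlt
    refine key _ _ 1 (lam / (lam + mu)) (by simp) (by positivity)
      ((div_le_one hs).2 (by linarith)) ?_
    simp only [HiddenTelegraph.lambdaHat, HiddenTelegraph.statMean, Matrix.cons_val_zero,
      Matrix.cons_val_one]
    field_simp
    ring
  · refine lt_of_le_of_lt (hV lam mu hl hm Ω P X₀ Y W hmod hM T hT k (2 * C) hk0 (by positivity)
      _ fun ω => ?_) hlt
    refine key _ _ (-1) (mu / (lam + mu)) (by simp) (by positivity)
      ((div_le_one hs).2 (by linarith)) ?_
    simp only [HiddenTelegraph.muHat, HiddenTelegraph.statMean, Matrix.cons_val_zero,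
      Matrix.cons_val_one]
    field_simp
    ring
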